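/- Let $d\ge 3$, let $\mathbb S^{d-1}\subset\mathbb R^d$ be the Euclidean unit sphere with its rotation-invariant probability measure $\omega$, and let $e^1,\dots,e^d$ be the canonical basis of $\mathbb R^d$. For $0<p<\infty$ put $\|f\|_{L^p}=(\int_{\mathbb S^{d-1}}|f|^p\,\mathrm d\omega)^{1/p}$, and put $\|f\|_{L^\infty}=\sup_{\eta\in\mathbb S^{d-1}}|f(\eta)|$. **Spherical harmonics.** Let $\theta_1\in(-\pi,\pi]$, $\theta_2,\dots,\theta_{d-1}\in[0,\pi]$ be spherical coordinates on $\mathbb S^{d-1}$, i.e. $x_1=\sin\theta_{d-1}\cdots\sin\theta_2\sin\theta_1$ and $x_i=\sin\theta_{d-1}\cdots\sin\theta_i\cos\theta_{i-1}$ for $2\le i\le d$. Let $C_m^\lambda$ be the Gegenbauer polynomials in the standard normalization $\sum_{m\ge0}C_m^\lambda(t)r^m=(1-2tr+r^2)^{-\lambda}$. For $n\in\mathbb N_0$ let $\mathcal I_n^d$ be the set of all $k=(k_1,\dots,k_{d-2})\in\mathbb N_0^{d-3}\times\mathbb Z$ with $n\ge k_1\ge\dots\ge k_{d-3}\ge|k_{d-2}|$;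 put $k_0=n$, and for $k\in\mathcal I_n^d$ let $$Y_k^{d,n}=A_k^n\prod_{j=0}^{d-3}C_{k_j-|k_{j+1}|}^{\frac{d-j-2}2+|k_{j+1}|}(\cos\theta_{d-j-1})\,\sin^{|k_{j+1}|}(\theta_{d-j-1})\;\mathrm e^{\mathrm i k_{d-2}\theta_1},$$ where $A_k^n>0$ and $$(A_k^n)^2=\frac{2^{(d-4)(d-2)}}{\Gamma(\frac d2)}\prod_{j=0}^{d-3}\frac{2^{2|k_{j+1}|-j}\,(k_j-|k_{j+1}|)!\,(2k_j+d-j-2)\,\Gamma^2(\frac{d-j-2}2+|k_{j+1}|)}{\sqrt\pi\,\Gamma(k_j+|k_{j+1}|+d-j-2)}.$$ Let $\mathcal H_n^d=\operatorname{span}_{\mathbb C}\{Y_k^{d,n}:k\in\mathcal I_n^d\}$. **Curvelets.** Let $q\in\mathbb N$, $q\ge1$, and let $\phi\in C^q([0,\infty))$ be real-valued and non-increasing with $\phi=1$ on $[0,1/2]$ and $\phi=0$ on $[1,\infty)$. Put $\kappa(t)=\sqrt{\phi^2(t/2)-\phi^2(t)}$ for $t\ge0$. Assume that $\kappa\in C^q([0,\infty))$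 and that there is $t_0\in(1/2,2)$ with $\kappa^{(q)}(t)\ne0$ for every $t\in(1/2,t_0)$. Let $\zeta_k^{d,n}=1/\sqrt2$ if $|k_{d-2}|=n$ and $\zeta_k^{d,n}=0$ otherwise, and let $$\Psi^0\equiv1,\qquad \Psi^j=\sum_{n=0}^\infty\sum_{k\in\mathcal I_n^d}\sqrt{\dim\mathcal H_n^d}\;\kappa\!\left(\frac n{2^{j-1}}\right)\zeta_k^{d,n}\,Y_k^{d,n}\quad(j\ge1).$$ Let $g_0\in SO(d)$ be any rotation with $g_0e^1=e^{d-1}$ and $g_0e^2=e^d$, and let $\Psi_{\mathrm C}^j(x)=\Psi^j(g_0^{-1}x)$ for $j\in\mathbb N_0$. **Claim.** If $0<p<\infty$ and $q>1/p$, then there are constants $0<c_1\le c_2$, depending only on $\kappa,q,p,d$, such that for all $j\in\mathbb N_0$ $$c_1\,2^{j\left(\frac{3d-2}4-\frac d{2p}\right)}\le\|\Psi_{\mathrm C}^j\|_{L^p}\le c_2\,2^{j\left(\frac{3d-2}4-\frac d{2p}\right)}.$$ Moreover, there are constants $0<c_1\le c_2$, depending only on $\kappa,q,d$, such that for all $j\in\mathbb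 N_0$ $$\|\Psi_{\mathrm C}^j\|_{L^\infty}=|\Psi_{\mathrm C}^j(e^d)|\qquad\text{and}\qquad c_1\,2^{j(3d-2)/4}\le|\Psi_{\mathrm C}^j(e^d)|\le c_2\,2^{j(3d-2)/4}.$$ -/

import Mathlib

namespace Curvelet

open MeasureTheory

/-- The unit sphere `𝕊^{d-1}` of `ℝ^d` with its Euclidean norm. -/
abbrev Sph (d : ℕ) : Type := Metric.sphere (0 : EuclideanSpace ℝ (Fin d)) 1

/-- The rotation-invariant probability measure on the sphere: the surface measure, divided by its
total mass. -/
noncomputable def sphMeasure (d : ℕ) : Measure (Sph d) :=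
  ((volume : Measure (EuclideanSpace ℝ (Fin d))).toSphere Set.univ)⁻¹ •
    (volume : Measure (EuclideanSpace ℝ (Fin d))).toSphere

/-- The `L^p` (quasi-)norm `(∫ |f|^p dω)^(1/p)`, for a real exponent `0 < p < ∞`, as an extended
nonnegative number. -/
noncomputable def lpNorm (d : ℕ) (p : ℝ) (f : Sph d → ℂ) : ENNReal :=
  eLpNorm f (ENNReal.ofReal p) (sphMeasure d)

/-- The supremum norm `sup_η |f(η)|`, as an extended nonnegative number. -/
noncomputable def supNorm (d : ℕ) (f : Sph d → ℂ) : ENNReal :=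
  ⨆ η : Sph d, ‖f η‖ₑ

/-- The canonical basis vector with (zero-based) index `i`, as a point of the sphere. The vector
written `e^m` in one-based notation is `basisPoint` at the index `m - 1`. -/
noncomputable def basisPoint {d : ℕ} (i : Fin d) : Sph d :=
  ⟨EuclideanSpace.single i 1, by simp⟩

theorem norm_mulVec_of_mem {d : ℕ} (g : Matrix.specialOrthogonalGroup (Fin d) ℝ)
    (x : EuclideanSpace ℝ (Fin d)) :
    ‖WithLp.toLp 2 (Matrix.mulVec (g : Matrix (Fin d) (Fin d) ℝ) x.ofLp)‖ = ‖x‖ := by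
  have hg := (Matrix.mem_orthogonalGroup_iff' (n := Fin d) (R := ℝ)).1
    ((Matrix.mem_specialOrthogonalGroup_iff (n := Fin d) (R := ℝ)).1 g.2).1
  have hd : dotProduct (Matrix.mulVec (g : Matrix (Fin d) (Fin d) ℝ) x.ofLp)
      (Matrix.mulVec (g : Matrix (Fin d) (Fin d) ℝ) x.ofLp) = dotProduct x.ofLp x.ofLp := by
    rw [Matrix.dotProduct_mulVec, Matrix.vecMul_mulVec, ← Matrix.dotProduct_mulVec]
    have : (Matrix.transpose (g : Matrix (Fin d) (Fin d) ℝ)) *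
      (g : Matrix (Fin d) (Fin d) ℝ) = 1 := hg
    simp [this]
  rw [EuclideanSpace.norm_eq, EuclideanSpace.norm_eq]
  congr 1
  simpa [dotProduct, sq] using hd

/-- The action `η ↦ g η` of a rotation matrix `g ∈ SO(d)` on the sphere. -/
noncomputable def rotate {d : ℕ} (g : Matrix.specialOrthogonalGroup (Fin d) ℝ) (η : Sph d) :
    Sph d :=
  ⟨WithLp.toLp 2 (Matrix.mulVec (g : Matrix (Fin d) (Fin d) ℝ) η.1.ofLp), by
    have h := norm_mulVec_of_mem g η.1
    have h1 : ‖η.1‖ = 1 := by simp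
    simpa [h1] using h⟩

/-- The rotation operator `T^d(g) f = f(g⁻¹ ·)`. -/
noncomputable def rotationOp {d : ℕ} (g : Matrix.specialOrthogonalGroup (Fin d) ℝ)
    (f : Sph d → ℂ) : Sph d → ℂ :=
  fun η => f (rotate g⁻¹ η)

/-! ### Spherical coordinates -/

/-- The one-based coordinate `x_i`, `1 ≤ i ≤ d`, of `x ∈ ℝ^d`. -/
noncomputable def coord {d : ℕ} (x : EuclideanSpace ℝ (Fin d)) (i : ℕ) : ℝ :=
  if h : i - 1 < d then x ⟨i - 1, h⟩ else 0

/-- The `i`-th (one-based) Cartesian coordinate of the point with spherical coordinates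
`θ_1, …, θ_{d-1}`: it is `sin θ_{d-1} ⋯ sin θ_2 sin θ_1` for `i = 1`, and
`sin θ_{d-1} ⋯ sin θ_i cos θ_{i-1}` for `2 ≤ i ≤ d`. -/
noncomputable def sphericalPoint (d : ℕ) (θ : ℕ → ℝ) (i : ℕ) : ℝ :=
  if i = 1 then (∏ m ∈ Finset.Icc 2 (d - 1), Real.sin (θ m)) * Real.sin (θ 1)
  else (∏ m ∈ Finset.Icc i (d - 1), Real.sin (θ m)) * Real.cos (θ (i - 1))

/-- `|(x_1, …, x_m)|`. -/
noncomputable def headNorm {d : ℕ} (x : EuclideanSpace ℝ (Fin d)) (m : ℕ) : ℝ :=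
  √(∑ i ∈ Finset.Icc 1 m, coord x i ^ 2)

/-- The spherical coordinates `θ_1 ∈ (-π, π]` and `θ_2, …, θ_{d-1} ∈ [0, π]` of a point of the
sphere. (Where the coordinates are not unique, the value taken is irrelevant.) -/
noncomputable def angle {d : ℕ} (x : EuclideanSpace ℝ (Fin d)) (m : ℕ) : ℝ :=
  if m = 1 then Complex.arg ⟨coord x 2, coord x 1⟩
  else Real.arccos (coord x (m + 1) / headNorm x (m + 1))

theorem headNorm_step {d : ℕ} (x : EuclideanSpace ℝ (Fin d)) (m : ℕ) (hm : 2 ≤ m) :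
    headNorm x m = headNorm x (m + 1) * Real.sin (angle x m) := by
  have hS : ∑ i ∈ Finset.Icc 1 (m+1), coord x i ^ 2 =
      ∑ i ∈ Finset.Icc 1 m, coord x i ^ 2 + coord x (m+1) ^ 2 :=
    Finset.sum_Icc_succ_top (by omega) _
  have h0 : 0 ≤ ∑ i ∈ Finset.Icc 1 m, coord x i ^ 2 := Finset.sum_nonneg fun i _ => sq_nonneg _
  have hn : 0 ≤ headNorm x (m+1) := Real.sqrt_nonneg _
  have hsq : headNorm x (m+1) ^ 2 = headNorm x m ^ 2 + coord x (m+1) ^ 2 := by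
    rw [headNorm, headNorm, Real.sq_sqrt (by rw [hS]; positivity), Real.sq_sqrt h0, hS]
  have hn' : 0 ≤ headNorm x m := Real.sqrt_nonneg _
  rw [angle, if_neg (by omega), Real.sin_arccos]
  rcases hn.eq_or_lt with h | h
  · rw [← h, zero_mul]; rw [← h] at hsq; nlinarith [sq_nonneg (coord x (m+1)), sq_nonneg (headNorm x m)]
  · have : 1 - (coord x (m + 1) / headNorm x (m + 1)) ^ 2 = (headNorm x m / headNorm x (m+1)) ^ 2 := by
      field_simp; linarith
    rw [this, Real.sqrt_sq (by positivity)]; field_simp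

theorem coord_step {d : ℕ} (x : EuclideanSpace ℝ (Fin d)) (m : ℕ) (hm : 2 ≤ m) :
    coord x (m + 1) = headNorm x (m + 1) * Real.cos (angle x m) := by
  have hS : ∑ i ∈ Finset.Icc 1 (m+1), coord x i ^ 2 =
      ∑ i ∈ Finset.Icc 1 m, coord x i ^ 2 + coord x (m+1) ^ 2 :=
    Finset.sum_Icc_succ_top (by omega) _
  have h0 : 0 ≤ ∑ i ∈ Finset.Icc 1 m, coord x i ^ 2 := Finset.sum_nonneg fun i _ => sq_nonneg _
  have hn : 0 ≤ headNorm x (m+1) := Real.sqrt_nonneg _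
  have hsq : headNorm x (m+1) ^ 2 = headNorm x m ^ 2 + coord x (m+1) ^ 2 := by
    rw [headNorm, headNorm, Real.sq_sqrt (by rw [hS]; positivity), Real.sq_sqrt h0, hS]
  have hle : |coord x (m+1)| ≤ headNorm x (m+1) :=
    abs_le_of_sq_le_sq (by nlinarith [sq_nonneg (headNorm x m)]) hn
  rw [angle, if_neg (by omega)]
  rcases hn.eq_or_lt with h | h
  · rw [← h] at hle; simpa [← h] using hle
  · rw [Real.cos_arccos]
    · field_simp
    · rw [le_div_iff₀ h]; linarith [(abs_le.1 hle).1]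
    · rw [div_le_one h]; exact (abs_le.1 hle).2

theorem headNorm_eq_prod {d : ℕ} (x : EuclideanSpace ℝ (Fin d)) (i : ℕ) (hi : 2 ≤ i) (N : ℕ) :
    headNorm x i = headNorm x (i + N) * ∏ m ∈ Finset.Icc i (i + N - 1), Real.sin (angle x m) := by
  induction N with
  | zero => simp [show Finset.Icc i (i-1) = ∅ by ext; simp; omega]
  | succ N ih =>
    have : i + (N+1) - 1 = (i + N - 1) + 1 := by omega
    rw [this, Finset.prod_Icc_succ_top (by omega), ih, headNorm_step x (i+N) (by omega)]
    have : i + N - 1 + 1 = i + N := by omega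
    rw [this, ← add_assoc]; ring

/-- The numbers `angle x m` are spherical coordinates of `x`. -/
theorem sphericalPoint_angle {d : ℕ} (hd : 2 ≤ d) (η : Sph d) (i : ℕ) (h1 : 1 ≤ i) (h2 : i ≤ d) :
    sphericalPoint d (angle η.1) i = coord η.1 i := by
  have hN : headNorm η.1 d = 1 := by
    have h1 : ‖η.1‖ = 1 := by simp
    rw [EuclideanSpace.norm_eq] at h1
    refine Eq.trans ?_ h1
    unfold headNorm
    congr 1
    rw [Finset.sum_fin_eq_sum_range]
    refine Finset.sum_bij' (fun i _ => i - 1) (fun i _ => i + 1) ?_ ?_ ?_ ?_ ?_ 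
    · intro a ha; simp at ha ⊢; omega
    · intro a ha; simp at ha ⊢; omega
    · intro a ha; simp at ha ⊢; omega
    · intro a ha; simp at ha ⊢
    · intro a ha; simp at ha; simp [coord]
  have hP : ∀ i, 2 ≤ i → i ≤ d → ∏ m ∈ Finset.Icc i (d - 1), Real.sin (angle η.1 m) = headNorm η.1 i := by
    intro i hi hid
    have := headNorm_eq_prod η.1 i hi (d - i)
    rw [show i + (d - i) = d by omega, hN, one_mul] at this
    exact this.symm
  have h2n : headNorm η.1 2 = ‖(⟨coord η.1 2, coord η.1 1⟩ : ℂ)‖ := by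
    rw [headNorm, Complex.norm_def, Complex.normSq_mk]
    congr 1
    simp [Finset.sum_Icc_succ_top]; ring
  unfold sphericalPoint
  split_ifs with h
  · subst h
    rw [hP 2 le_rfl hd, angle, if_pos rfl, h2n, Complex.norm_mul_sin_arg]
  · rw [hP i (by omega) h2]
    rcases (show i = 2 ∨ 3 ≤ i by omega) with rfl | h3
    · rw [angle, if_pos rfl, h2n, Complex.norm_mul_cos_arg]
    · obtain ⟨m, rfl⟩ : ∃ m, i = m + 1 := ⟨i - 1, by omega⟩
      rw [coord_step η.1 m (by omega)]; rfl

/-! ### Spherical harmonics -/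

/-- The Gegenbauer polynomials `C_m^lam(t)` with the standard normalization
(`C_0 = 1`, `C_1 = 2 lam t`, generating function `(1 - 2 t r + r ^ 2) ^ (-lam)`), through their
three-term recurrence `m C_m = 2 (m + lam - 1) t C_{m-1} - (m + 2 lam - 2) C_{m-2}`. -/
noncomputable def gegenbauer (lam : ℝ) : ℕ → ℝ → ℝ
  | 0, _ => 1
  | 1, t => 2 * lam * t
  | m + 2, t =>
    (2 * ((m : ℝ) + 1 + lam) * t * gegenbauer lam (m + 1) t
      - ((m : ℝ) + 2 * lam) * gegenbauer lam m t) / ((m : ℝ) + 2)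

/-- For a multi-index `k = (k_1, …, k_{d-2})` (stored with zero-based positions) of degree `n`,
the integer `k_j`, `0 ≤ j ≤ d - 2`, where `k_0 = n`. -/
def idx (d n : ℕ) (k : Fin (d - 2) → ℤ) : ℕ → ℤ
  | 0 => n
  | j + 1 => if h : j < d - 2 then k ⟨j, h⟩ else 0

/-- `|k_j|` as a natural number. -/
def absIdx (d n : ℕ) (k : Fin (d - 2) → ℤ) (j : ℕ) : ℕ := (idx d n k j).natAbs

/-- The index set of all `k ∈ ℕ_0^{d-3} × ℤ` with `n ≥ k_1 ≥ ⋯ ≥ k_{d-3} ≥ |k_{d-2}|`. The box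
`[-n, n]^{d-2}` only serves to make it a `Finset`. -/
noncomputable def indexSet (d n : ℕ) : Finset (Fin (d - 2) → ℤ) :=
  (Fintype.piFinset fun _ => Finset.Icc (-(n : ℤ)) n).filter fun k : Fin (d - 2) → ℤ =>
    (∀ j < d - 2, 0 ≤ idx d n k j) ∧
      ∀ j < d - 2, (absIdx d n k (j + 1) : ℤ) ≤ idx d n k j

/-- The normalization constants `A_k^n > 0`, written through their squares. -/
noncomputable def normConst (d n : ℕ) (k : Fin (d - 2) → ℤ) : ℝ :=
  √((2 : ℝ) ^ (((d : ℤ) - 4) * ((d : ℤ) - 2)) / Real.Gamma ((d : ℝ) / 2) *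
    ∏ j ∈ Finset.range (d - 2),
      ((2 : ℝ) ^ (2 * (absIdx d n k (j + 1) : ℤ) - (j : ℤ)) *
          (Nat.factorial (absIdx d n k j - absIdx d n k (j + 1)) : ℝ) *
          (2 * (absIdx d n k j : ℝ) + d - j - 2) *
          Real.Gamma (((d : ℝ) - j - 2) / 2 + absIdx d n k (j + 1)) ^ 2 /
        (√Real.pi * Real.Gamma ((absIdx d n k j : ℝ) + absIdx d n k (j + 1) + d - j - 2))))

/-- The spherical harmonic `Y_k^{d,n}` as a function of the spherical coordinates. -/
noncomputable def harmonicOfAngles (d n : ℕ) (k : Fin (d - 2) → ℤ) (θ : ℕ → ℝ) : ℂ :=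
  ((normConst d n k * ∏ j ∈ Finset.range (d - 2),
      (gegenbauer (((d : ℝ) - j - 2) / 2 + absIdx d n k (j + 1))
          (absIdx d n k j - absIdx d n k (j + 1)) (Real.cos (θ (d - j - 1))) *
        Real.sin (θ (d - j - 1)) ^ absIdx d n k (j + 1)) : ℝ) : ℂ) *
    Complex.exp (Complex.I * (idx d n k (d - 2) : ℂ) * (θ 1 : ℂ))

/-- The spherical harmonic `Y_k^{d,n}` on the sphere. -/
noncomputable def harmonic (d n : ℕ) (k : Fin (d - 2) → ℤ) : Sph d → ℂ :=
  fun η => harmonicOfAngles d n k (angle η.1)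

/-- The space `𝓗_n^d` of spherical harmonics of degree `n`: the span of the `Y_k^{d,n}`. -/
noncomputable def harmonicSpace (d n : ℕ) : Submodule ℂ (Sph d → ℂ) :=
  Submodule.span ℂ ((fun k => harmonic d n k) '' (indexSet d n : Set (Fin (d - 2) → ℤ)))

/-! ### Curvelets -/

/-- The window `κ(t) = √(φ(t/2)² - φ(t)²)`. -/
noncomputable def window (φ : ℝ → ℝ) (t : ℝ) : ℝ := √(φ (t / 2) ^ 2 - φ t ^ 2)

/-- The directionality components: `1/√2` if `|k_{d-2}| = n`, and `0` otherwise. -/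
noncomputable def directionality (d n : ℕ) (k : Fin (d - 2) → ℤ) : ℝ :=
  if absIdx d n k (d - 2) = n then 1 / √2 else 0

/-- The initial sequence: `Ψ^0 = 1` and
`Ψ^j = ∑_n ∑_k √(dim 𝓗_n) κ(n / 2^{j-1}) ζ_k Y_k` for `j ≥ 1`. For a window supported in
`[1/2, 2]` only finitely many `n` contribute. -/
noncomputable def curvelet₀ (d : ℕ) (φ : ℝ → ℝ) : ℕ → Sph d → ℂ
  | 0, _ => 1
  | j + 1, η => ∑' n : ℕ, ∑ k ∈ indexSet d n,
      ((√(Module.finrank ℂ (harmonicSpace d n) : ℝ) * window φ ((n : ℝ) / 2 ^ j) *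
        directionality d n k : ℝ) : ℂ) * harmonic d n k η

/-- The polynomial curvelets `Ψ_C^j = T^d(g₀) Ψ^j`. -/
noncomputable def curvelet (d : ℕ) (φ : ℝ → ℝ) (g₀ : Matrix.specialOrthogonalGroup (Fin d) ℝ)
    (j : ℕ) : Sph d → ℂ :=
  rotationOp g₀ (curvelet₀ d φ j)

end Curvelet

/-!
The directionality components select the multi-indices `k = (n, …, n, ±n)`. For these all Gegenbauer
factors are constant, so that `Y_k` is a multiple of `(x_2 ± i x_1) ^ n`, and the two terms add up to
a real part. After the rotation `g₀`, the curvelet of scale `N = 2 ^ (j - 1)` at a point `η` of the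
sphere is `Re F_N(z)`, where `F_N(z) = ∑ b_n κ(n / N) z ^ n` (`kernel`), the number
`z = η_d + i η_{d-1}` lies in the unit disc (`planePart`), and `b_n = √2 √(dim 𝓗_n) A_n` is positive
(`amplitude`). No invariance of the measure is needed for this (`curvelet_succ_eq`).

The size of the amplitudes gives the size at the pole. With `α = 3 (d - 2) / 4` one has
`b_n ~ n ^ α`, hence `F_N(1) ~ N ^ (α + 1)`, and `α + 1 = (3 d - 2) / 4`. As all coefficients are
nonnegative, `|Re F_N(z)| ≤ F_N(1)` on the disc, which is the statement about the supremum norm.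

The smoothness of the amplitudes in `n` gives localization. The `l`-th difference of `b_n` is
`O(n ^ (α - l))` (`amplitude_symbol`): the dimension of `𝓗_n` is the number of multi-indices, by
linear independence of the `Y_k`, and its difference in `n` is the same number in one dimension less;
`A_n ^ 2` is a multiple of `Γ(n + d / 2) / Γ(n + 1)`, by the duplication formula and telescoping, and
this quotient satisfies a first-order recursion; square roots of such sequences are of the same kind
(`IsSymbol.sqrt`). The sequences `n ↦ κ(n / N)` have order zero uniformly in `N`, so `q` summations
by parts show that `F_N` is `O(N ^ (α + 1))` times
`(1 + N |η_{d-1}|) ^ (-q) exp (-N (1 - |z|²) / 4)` (`kernel_bound`).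

Hence the curvelet lives on a cap of length `1 / N` in the direction of `η_{d-1}` and of length
`1 / √N` in the remaining `d - 2` directions, that is, of measure `N ^ (-d / 2)`. The `p`-th power of
the majorant is integrable with this scaling because `q p > 1` (`lintegral_majorant_le`). Conversely,
where `|z - 1| ≤ 1 / (4 N)`, all powers `z ^ n` with `n ≤ 2 N` have real part at least `1 / 2`, so
that `Re F_N(z) ≥ F_N(1) / 2` on a set of measure at least `c N ^ (-d / 2)`
(`sphMeasure_near_one_ge`). Together these are the bounds for the `L^p` norm. The integrals over the
sphere are computed in the unit ball, as the measure is the image of Lebesgue measure under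
`x ↦ x / |x|`.
-/

namespace Curvelet

open MeasureTheory

/-! ### Finite differences and discrete symbols -/

/-- Discrete symbols of order `a` and regularity `m`, for a family of sequences `f i`: for every
`l ≤ m` the `l`-th forward difference is `O((n + 1) ^ (a - l))`, uniformly in `i`. The recursive
form (take a difference, lower the order by one) makes the closure properties inductions on `m`. -/
def IsSymbol {ι : Type*} : ℕ → ℝ → (ι → ℕ → ℝ) → Prop
  | 0, a, f => ∃ C : ℝ, ∀ i n, |f i n| ≤ C * ((n : ℝ) + 1) ^ a
  | m + 1, a, f => (∃ C : ℝ, ∀ i n, |f i n| ≤ C * ((n : ℝ) + 1) ^ a) ∧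
      IsSymbol m (a - 1) (fun i n => f i (n + 1) - f i n)

namespace IsSymbol

variable {ι : Type*} {m : ℕ} {a b : ℝ} {f g : ι → ℕ → ℝ}

theorem bound (hf : IsSymbol m a f) : ∃ C : ℝ, ∀ i n, |f i n| ≤ C * ((n : ℝ) + 1) ^ a := by
  cases m with
  | zero => exact hf
  | succ m => exact hf.1

theorem bound_pos (hf : IsSymbol m a f) :
    ∃ C : ℝ, 0 < C ∧ ∀ i n, |f i n| ≤ C * ((n : ℝ) + 1) ^ a := by
  obtain ⟨C, hC⟩ := hf.bound
  refine ⟨max C 1, by positivity, fun i n => (hC i n).trans ?_⟩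
  gcongr
  exact le_max_left _ _

theorem of_succ (hf : IsSymbol (m + 1) a f) : IsSymbol m a f := by
  induction m generalizing a f with
  | zero => exact hf.1
  | succ m ih => exact ⟨hf.1, ih hf.2⟩

theorem add (hf : IsSymbol m a f) (hg : IsSymbol m a g) :
    IsSymbol m a (fun i n => f i n + g i n) := by
  have key : ∃ C : ℝ, ∀ i n, |f i n + g i n| ≤ C * ((n : ℝ) + 1) ^ a := by
    obtain ⟨C, hC⟩ := hf.bound
    obtain ⟨D, hD⟩ := hg.bound
    refine ⟨C + D, fun i n => (abs_add_le _ _).trans ?_⟩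
    rw [add_mul]
    exact add_le_add (hC i n) (hD i n)
  induction m generalizing a f g with
  | zero => exact key
  | succ m ih =>
    refine ⟨key, ?_⟩
    convert ih hf.2 hg.2 ?_ using 3
    · ring
    · obtain ⟨C, hC⟩ := hf.2.bound
      obtain ⟨D, hD⟩ := hg.2.bound
      refine ⟨C + D, fun i n => (abs_add_le _ _).trans ?_⟩
      rw [add_mul]
      exact add_le_add (hC i n) (hD i n)

theorem shift (hf : IsSymbol m a f) : IsSymbol m a (fun i n => f i (n + 1)) := by
  induction m generalizing a f with
  | zero =>
    obtain ⟨C, hC0, hC⟩ := hf.bound_pos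
    refine ⟨C * 2 ^ |a|, fun i n => (hC i (n + 1)).trans ?_⟩
    have h1 : (0 : ℝ) < (n : ℝ) + 1 := by positivity
    have h2 : (((n + 1 : ℕ) : ℝ) + 1) ^ a ≤ 2 ^ |a| * ((n : ℝ) + 1) ^ a := by
      have h3 : (((n + 1 : ℕ) : ℝ) + 1) = (((n : ℝ) + 2) / (n + 1)) * (n + 1) := by
        field_simp; push_cast; ring
      rw [h3, Real.mul_rpow (by positivity) h1.le]
      gcongr
      have h4 : 1 ≤ ((n : ℝ) + 2) / (n + 1) := by rw [le_div_iff₀ h1]; linarith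
      calc (((n : ℝ) + 2) / (n + 1)) ^ a ≤ (((n : ℝ) + 2) / (n + 1)) ^ |a| :=
            Real.rpow_le_rpow_of_exponent_le h4 (le_abs_self a)
        _ ≤ 2 ^ |a| := by
            gcongr
            rw [div_le_iff₀ h1]; linarith
    nlinarith
  | succ m ih =>
    exact ⟨(ih (of_succ hf)).bound, ih hf.2⟩

theorem mul (hf : IsSymbol m a f) (hg : IsSymbol m b g) :
    IsSymbol m (a + b) (fun i n => f i n * g i n) := by
  induction m generalizing a b f g with
  | zero =>
    obtain ⟨C, hC⟩ := hf
    obtain ⟨D, hD⟩ := hg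
    refine ⟨C * D, fun i n => ?_⟩
    have h1 : (0 : ℝ) < (n : ℝ) + 1 := by positivity
    rw [abs_mul, Real.rpow_add h1]
    calc |f i n| * |g i n| ≤ (C * ((n : ℝ) + 1) ^ a) * (D * ((n : ℝ) + 1) ^ b) :=
          mul_le_mul (hC i n) (hD i n) (abs_nonneg _) ((abs_nonneg _).trans (hC i n))
      _ = _ := by ring
  | succ m ih =>
    refine ⟨(ih hf.of_succ hg.of_succ).bound, ?_⟩
    have h1 := ih hf.2 hg.of_succ.shift
    have h2 := ih hf.of_succ hg.2
    rw [show a - 1 + b = a + b - 1 by ring] at h1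
    rw [show a + (b - 1) = a + b - 1 by ring] at h2
    convert h1.add h2 using 3
    ring

theorem neg (hf : IsSymbol m a f) : IsSymbol m a (fun i n => -f i n) := by
  induction m generalizing a f with
  | zero =>
    obtain ⟨C, hC⟩ := hf
    exact ⟨C, fun i n => by rw [abs_neg]; exact hC i n⟩
  | succ m ih =>
    refine ⟨(ih hf.of_succ).bound, ?_⟩
    convert ih hf.2 using 3
    ring

theorem zero : IsSymbol m a (fun (_ : ι) _ => 0) := by
  induction m generalizing a with
  | zero => exact ⟨0, by simp⟩
  | succ m ih => exact ⟨⟨0, by simp⟩, by simpa using ih⟩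

theorem const (c : ℝ) : IsSymbol m 0 (fun (_ : ι) _ => c) := by
  cases m with
  | zero => exact ⟨|c|, by simp⟩
  | succ m => exact ⟨⟨|c|, by simp⟩, by simpa using zero⟩

theorem const_mul (c : ℝ) (hf : IsSymbol m a f) : IsSymbol m a (fun i n => c * f i n) := by
  simpa using (const (ι := ι) (m := m) c).mul hf

theorem affine (c e : ℝ) : IsSymbol m 1 (fun (_ : ι) n => c * n + e) := by
  have key : ∃ C : ℝ, ∀ (_ : ι) (n : ℕ), |c * n + e| ≤ C * ((n : ℝ) + 1) ^ (1 : ℝ) := by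
    refine ⟨|c| + |e|, fun _ n => (abs_add_le _ _).trans ?_⟩
    rw [abs_mul, Nat.abs_cast, Real.rpow_one]
    have := abs_nonneg c
    have := abs_nonneg e
    have : (0 : ℝ) ≤ n := by positivity
    nlinarith [mul_nonneg (abs_nonneg e) this]
  cases m with
  | zero => exact key
  | succ m =>
    refine ⟨key, ?_⟩
    convert const (ι := ι) (m := m) c using 3
    · ring
    · push_cast; ring

/-- Symbols that are bounded below by their order (elliptic symbols) have reciprocals. -/
theorem inv (hf : IsSymbol m a f) {c : ℝ} (hc : 0 < c)
    (hlow : ∀ i (n : ℕ), c * ((n : ℝ) + 1) ^ a ≤ f i n) :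
    IsSymbol m (-a) (fun i n => (f i n)⁻¹) := by
  have hpos : ∀ i n, 0 < f i n := fun i n =>
    (by positivity : (0 : ℝ) < c * ((n : ℝ) + 1) ^ a).trans_le (hlow i n)
  have key : ∃ C : ℝ, ∀ i n, |(f i n)⁻¹| ≤ C * ((n : ℝ) + 1) ^ (-a) := by
    refine ⟨c⁻¹, fun i n => ?_⟩
    rw [abs_of_pos (inv_pos.2 (hpos i n)), Real.rpow_neg (by positivity), ← mul_inv]
    exact inv_anti₀ (by positivity) (hlow i n)
  induction m with
  | zero => exact key
  | succ m ih =>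
    refine ⟨key, ?_⟩
    have h1 := ih hf.of_succ
    have h2 := (hf.2.neg.mul h1).mul h1.shift
    rw [show a - 1 + -a + -a = -a - 1 by ring] at h2
    convert h2 using 3 with i n
    have := (hpos i n).ne'
    have := (hpos i (n + 1)).ne'
    field_simp
    ring

/-- The positive square root of an elliptic symbol of order `2 a` is a symbol of order `a`:
`Δ √f = Δ f / (√f(n + 1) + √f(n))`. -/
theorem sqrt (hf : IsSymbol m (2 * a) f) {c : ℝ} (hc : 0 < c)
    (hlow : ∀ i (n : ℕ), c * ((n : ℝ) + 1) ^ (2 * a) ≤ f i n) :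
    IsSymbol m a (fun i n => √(f i n)) := by
  have hpow : ∀ n : ℕ, ((n : ℝ) + 1) ^ (2 * a) = (((n : ℝ) + 1) ^ a) ^ 2 := fun n => by
    rw [← Real.rpow_natCast, ← Real.rpow_mul (by positivity)]; congr 1; push_cast; ring
  have hpos : ∀ i n, 0 < f i n := fun i n =>
    (by positivity : (0 : ℝ) < c * ((n : ℝ) + 1) ^ (2 * a)).trans_le (hlow i n)
  have key : ∃ C : ℝ, ∀ i n, |√(f i n)| ≤ C * ((n : ℝ) + 1) ^ a := by
    obtain ⟨C, hC0, hC⟩ := hf.bound_pos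
    refine ⟨√C, fun i n => ?_⟩
    rw [abs_of_nonneg (Real.sqrt_nonneg _),
      show √C * ((n : ℝ) + 1) ^ a = √(C * ((n : ℝ) + 1) ^ (2 * a)) by
        rw [Real.sqrt_mul hC0.le, hpow, Real.sqrt_sq (by positivity)]]
    exact Real.sqrt_le_sqrt ((le_abs_self _).trans (hC i n))
  have hlow' : ∀ i (n : ℕ), √c * ((n : ℝ) + 1) ^ a ≤ √(f i n) := fun i n => by
    rw [show √c * ((n : ℝ) + 1) ^ a = √(c * ((n : ℝ) + 1) ^ (2 * a)) by
        rw [Real.sqrt_mul hc.le, hpow, Real.sqrt_sq (by positivity)]]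
    exact Real.sqrt_le_sqrt (hlow i n)
  induction m with
  | zero => exact key
  | succ m ih =>
    refine ⟨key, ?_⟩
    have h1 := ih hf.of_succ
    have h2 := (h1.shift.add h1).inv (c := √c) (Real.sqrt_pos.2 hc) (fun i n => by
      have := hlow' i n
      have := Real.sqrt_nonneg (f i (n + 1))
      linarith)
    have h3 := hf.2.mul h2
    rw [show 2 * a - 1 + -a = a - 1 by ring] at h3
    convert h3 using 3 with i n
    have h4 : 0 < √(f i (n + 1)) + √(f i n) :=
      add_pos (Real.sqrt_pos.2 (hpos _ _)) (Real.sqrt_pos.2 (hpos _ _))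
    rw [eq_mul_inv_iff_mul_eq₀ h4.ne']
    nlinarith [Real.sq_sqrt (hpos i n).le, Real.sq_sqrt (hpos i (n + 1)).le]

theorem of_fwdDiff (h : ∀ l ≤ m, ∃ C : ℝ, ∀ i n,
    |(fwdDiff 1)^[l] (f i) n| ≤ C * ((n : ℝ) + 1) ^ (a - l)) : IsSymbol m a f := by
  induction m generalizing a f with
  | zero =>
    obtain ⟨C, hC⟩ := h 0 le_rfl
    exact ⟨C, fun i n => by simpa using hC i n⟩
  | succ m ih =>
    refine ⟨by simpa using h 0 (by omega), ih fun l hl => ?_⟩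
    obtain ⟨C, hC⟩ := h (l + 1) (by omega)
    refine ⟨C, fun i n => ?_⟩
    have := hC i n
    rw [Function.iterate_succ_apply] at this
    rw [show a - 1 - (l : ℝ) = a - ((l + 1 : ℕ) : ℝ) by push_cast; ring]
    exact this

theorem fwdDiff_bound (h : IsSymbol m a f) : ∃ C : ℝ, 0 < C ∧ ∀ i n,
    |(fwdDiff 1)^[m] (f i) n| ≤ C * ((n : ℝ) + 1) ^ (a - m) := by
  induction m generalizing a f with
  | zero => simpa using h.bound_pos
  | succ m ih =>
    obtain ⟨C, hC0, hC⟩ := ih h.2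
    refine ⟨C, hC0, fun i n => ?_⟩
    rw [Function.iterate_succ_apply]
    rw [show a - ((m + 1 : ℕ) : ℝ) = a - 1 - (m : ℝ) by push_cast; ring]
    exact hC i n

end IsSymbol

theorem fwdDiff_iter_eq_zero {f : ℕ → ℝ} {l n : ℕ} (h : ∀ k, n ≤ k → k ≤ n + l → f k = 0) :
    (fwdDiff 1)^[l] f n = 0 := by
  induction l generalizing f with
  | zero => exact h n le_rfl le_rfl
  | succ l ih =>
    rw [Function.iterate_succ_apply]
    refine ih fun k h1 h2 => ?_
    rw [fwdDiff, h k h1 (by omega), h (k + 1) (by omega) (by omega), sub_zero]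

/-- A forward difference is controlled by the derivative of the same order. -/
theorem abs_fwdDiff_iter_le {f : ℝ → ℝ} {l : ℕ} (hf : ContDiff ℝ l f) {M : ℝ}
    (hM : ∀ x, |iteratedDeriv l f x| ≤ M) {h : ℝ} (hh : 0 ≤ h) (x : ℝ) :
    |(fwdDiff h)^[l] f x| ≤ M * h ^ l := by
  induction l generalizing f M with
  | zero => simpa using hM x
  | succ l ih =>
    rw [Function.iterate_succ_apply]
    have hl : ContDiff ℝ l f := hf.of_le (by exact_mod_cast Nat.le_succ l)
    have hs : ContDiff ℝ l (fun y => f (y + h)) := hl.comp (contDiff_id.add contDiff_const)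
    have := ih (f := fwdDiff h f) (M := M * h) (hs.sub hl) (fun y => ?_)
    · rw [pow_succ']; linarith
    · have e : iteratedDeriv l (fwdDiff h f) y
          = iteratedDeriv l f (y + h) - iteratedDeriv l f y := by
        have := iteratedDeriv_sub (x := y) hs.contDiffAt hl.contDiffAt
        rw [iteratedDeriv_comp_add_const] at this
        exact this
      rw [e]
      have hd : Differentiable ℝ (iteratedDeriv l f) :=
        hf.differentiable_iteratedDeriv l (by exact_mod_cast Nat.lt_succ_self l)
      have := Convex.norm_image_sub_le_of_norm_deriv_le (𝕜 := ℝ) (f := iteratedDeriv l f)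
        (s := Set.univ) (x := y) (y := y + h) (C := M) (fun z _ => hd z)
        (fun z _ => by rw [← iteratedDeriv_succ]; exact hM z) convex_univ trivial trivial
      simpa [abs_of_nonneg hh] using this

theorem fwdDiff_iter_comp_div (f : ℝ → ℝ) (N : ℝ) (l n : ℕ) :
    (fwdDiff 1)^[l] (fun k : ℕ => f (k / N)) n = (fwdDiff (1 / N))^[l] f (n / N) := by
  induction l generalizing f with
  | zero => rfl
  | succ l ih =>
    rw [Function.iterate_succ_apply, Function.iterate_succ_apply, ← ih]
    have : fwdDiff 1 (fun k : ℕ => f (k / N)) = fun k : ℕ => fwdDiff (1 / N) f (k / N) := by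
      funext k
      simp only [fwdDiff]
      push_cast
      rw [add_div]
    rw [this]

theorem hasCompactSupport_iteratedDeriv {f : ℝ → ℝ} (hf : HasCompactSupport f) (l : ℕ) :
    HasCompactSupport (iteratedDeriv l f) := by
  induction l with
  | zero => simpa using hf
  | succ l ih => rw [iteratedDeriv_succ]; exact ih.deriv

/-- Dilates `n ↦ K(n / N)` of a compactly supported `C^q` function are symbols of order zero,
uniformly in `N ≥ 1`: the `l`-th difference is `O(N ^ (-l))`, and it vanishes for `n > 2 N`. -/
theorem isSymbol_dilate {K : ℝ → ℝ} {q : ℕ} (hK : ContDiff ℝ q K) (hc : HasCompactSupport K)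
    (h2 : ∀ t, 2 ≤ t → K t = 0) :
    IsSymbol q 0 (fun (N : {N : ℕ // 1 ≤ N}) n => K ((n : ℝ) / (N : ℕ))) := by
  refine IsSymbol.of_fwdDiff fun l hl => ?_
  have hl' : (l : WithTop ℕ∞) ≤ q := by exact_mod_cast hl
  obtain ⟨M, hM⟩ := (hK.continuous_iteratedDeriv l hl').bounded_above_of_compact_support
    (hasCompactSupport_iteratedDeriv hc l)
  have hM0 : 0 ≤ M := (norm_nonneg _).trans (hM 0)
  refine ⟨M * 3 ^ l, ?_⟩
  rintro ⟨N, hN⟩ n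
  have hN' : (1 : ℝ) ≤ N := by exact_mod_cast hN
  rw [zero_sub, Real.rpow_neg (by positivity), Real.rpow_natCast]
  by_cases hn : 2 * N ≤ n
  · rw [fwdDiff_iter_eq_zero]
    · rw [abs_zero]; positivity
    · intro k hk _
      apply h2
      rw [le_div_iff₀ (by positivity)]
      exact_mod_cast hn.trans hk
  · rw [fwdDiff_iter_comp_div]
    refine (abs_fwdDiff_iter_le (hK.of_le hl') hM (by positivity) _).trans ?_
    rw [mul_assoc, ← div_eq_mul_inv, ← div_pow]
    refine mul_le_mul_of_nonneg_left (pow_le_pow_left₀ (by positivity) ?_ _) hM0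
    rw [div_le_div_iff₀ (by positivity) (by positivity)]
    have : (n : ℝ) + 1 ≤ 2 * N := by exact_mod_cast not_le.1 hn
    linarith

/-! ### Localization of the kernel `∑ b n K(n / N) z ^ n` -/

theorem IsSymbol.reindex {ι τ : Type*} {m : ℕ} {a : ℝ} {f : ι → ℕ → ℝ} (hf : IsSymbol m a f)
    (e : τ → ι) : IsSymbol m a (fun i => f (e i)) := by
  induction m generalizing a f with
  | zero =>
    obtain ⟨C, hC⟩ := hf
    exact ⟨C, fun i n => hC (e i) n⟩
  | succ m ih =>
    obtain ⟨⟨C, hC⟩, h2⟩ := hf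
    exact ⟨⟨C, fun i n => hC (e i) n⟩, ih h2⟩

theorem rpow_le_of_comparable {x y A : ℝ} (a : ℝ) (hx : 0 < x) (hy : 0 < y) (hA : 1 ≤ A)
    (h1 : y ≤ A * x) (h2 : x ≤ A * y) : x ^ a ≤ A ^ |a| * y ^ a := by
  rcases le_total 0 a with ha | ha
  · rw [abs_of_nonneg ha, ← Real.mul_rpow (by positivity) hy.le]
    exact Real.rpow_le_rpow hx.le h2 ha
  · rw [abs_of_nonpos ha, Real.rpow_neg (by positivity), ← Real.inv_rpow (by positivity),
      ← Real.mul_rpow (by positivity) hy.le]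
    refine Real.rpow_le_rpow_of_nonpos (by positivity) ?_ ha
    rw [inv_mul_le_iff₀ (by positivity)]
    exact h1

/-- The decay of powers in terms of the distance of `z` to the unit circle. -/
theorem norm_pow_le_exp {z : ℂ} {n : ℕ} {N : ℝ} (hz : ‖z‖ ≤ 1) (hn : N ≤ 2 * n) :
    ‖z‖ ^ n ≤ Real.exp (-(N * (1 - ‖z‖ ^ 2)) / 4) := by
  have h0 : 0 ≤ 1 - ‖z‖ ^ 2 := by nlinarith [norm_nonneg z]
  have h1 : ‖z‖ ≤ Real.exp (-(1 - ‖z‖ ^ 2) / 2) := by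
    refine abs_le_of_sq_le_sq' ?_ (Real.exp_nonneg _) |>.2
    rw [← Real.exp_nat_mul]
    have := Real.add_one_le_exp (‖z‖ ^ 2 - 1)
    calc ‖z‖ ^ 2 ≤ Real.exp (‖z‖ ^ 2 - 1) := by linarith
      _ = _ := by congr 1; push_cast; ring
  calc ‖z‖ ^ n ≤ Real.exp (-(1 - ‖z‖ ^ 2) / 2) ^ n := pow_le_pow_left₀ (norm_nonneg _) h1 n
    _ = Real.exp (n * (-(1 - ‖z‖ ^ 2) / 2)) := (Real.exp_nat_mul _ _).symm
    _ ≤ _ := by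
      apply Real.exp_le_exp.2
      nlinarith [mul_le_mul_of_nonneg_right hn h0]

/-- Summation by parts `l` times; there are no boundary terms, as `a` vanishes near both ends. -/
theorem one_sub_pow_mul_sum {a : ℕ → ℝ} {l M : ℕ} (h0 : ∀ n < l, a n = 0)
    (hM : ∀ n, M ≤ n → a n = 0) (z : ℂ) :
    (1 - z) ^ l * ∑ n ∈ Finset.range M, (a n : ℂ) * z ^ n =
      z ^ l * ∑ n ∈ Finset.range M, (((fwdDiff 1)^[l] a n : ℝ) : ℂ) * z ^ n := by
  induction l generalizing a with
  | zero => simp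
  | succ l ih =>
    have key : (1 - z) * ∑ n ∈ Finset.range M, (a n : ℂ) * z ^ n =
        z * ∑ n ∈ Finset.range M, ((fwdDiff 1 a n : ℝ) : ℂ) * z ^ n := by
      have h1 := Finset.sum_range_succ (fun n => (a n : ℂ) * z ^ n) M
      have h2 := Finset.sum_range_succ' (fun n => (a n : ℂ) * z ^ n) M
      rw [hM M le_rfl] at h1
      rw [h0 0 (by omega)] at h2
      have h3 : ∑ n ∈ Finset.range M, ((fwdDiff 1 a n : ℝ) : ℂ) * z ^ n * z =
          ∑ n ∈ Finset.range M, (a (n + 1) : ℂ) * z ^ (n + 1) -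
            (∑ n ∈ Finset.range M, (a n : ℂ) * z ^ n) * z := by
        rw [Finset.sum_mul, ← Finset.sum_sub_distrib]
        refine Finset.sum_congr rfl fun n _ => ?_
        rw [fwdDiff]
        push_cast
        ring
      rw [mul_comm z, Finset.sum_mul, h3]
      simp only [Complex.ofReal_zero, zero_mul, add_zero] at h1 h2
      rw [← h2, h1]
      ring
    have ih' := ih (a := fwdDiff 1 a)
      (fun n hn => by rw [fwdDiff, h0 n (by omega), h0 (n + 1) (by omega), sub_zero])
      (fun n hn => by rw [fwdDiff, hM n hn, hM (n + 1) (by omega), sub_zero])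
    rw [Function.iterate_succ_apply, pow_succ, mul_assoc, key, mul_left_comm, ih', pow_succ]
    ring

/-- The polynomial `∑ b n κ(n / N) z ^ n` whose real part is the curvelet of scale `N`. -/
noncomputable def kernel (b : ℕ → ℝ) (K : ℝ → ℝ) (N : ℕ) (z : ℂ) : ℂ :=
  ∑ n ∈ Finset.range (2 * N), ((b n * K (n / N) : ℝ) : ℂ) * z ^ n

/-- Localization: the kernel has size `N ^ (α + 1)`, and decays at the scale `1 / N` in the
direction `Im z` and in the distance of `z` to the unit circle. -/
theorem kernel_bound {K : ℝ → ℝ} {q : ℕ} (hK : ContDiff ℝ q K) (hc : HasCompactSupport K)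
    (hK1 : ∀ t, t ≤ 1 / 2 → K t = 0) (hK2 : ∀ t, 2 ≤ t → K t = 0)
    {b : ℕ → ℝ} {α : ℝ} (hb : IsSymbol q α (fun _ : Unit => b)) :
    ∃ C : ℝ, 0 < C ∧ ∀ N : ℕ, 1 ≤ N → ∀ z : ℂ, ‖z‖ ≤ 1 →
      ‖kernel b K N z‖ * (1 + N * |z.im|) ^ q ≤
        C * (N : ℝ) ^ (α + 1) * Real.exp (-(N * (1 - ‖z‖ ^ 2)) / 4) := by
  have hsym := (hb.reindex (fun _ : {N : ℕ // 1 ≤ N} => ())).mul (isSymbol_dilate hK hc hK2)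
  rw [add_zero] at hsym
  obtain ⟨C₀, hC₀, hbd₀⟩ := hsym.bound_pos
  obtain ⟨C₁, hC₁, hbd₁⟩ := hsym.fwdDiff_bound
  set A : ℝ := 2 * (q + 1) with hA
  have hA1 : 1 ≤ A := by rw [hA]; have : (0 : ℝ) ≤ q := by positivity
                         linarith
  set D : ℝ := 2 * C₀ * 3 ^ |α| with hD
  set E : ℝ := 2 * C₁ * (A + 1) ^ |α - q| with hE
  have hDpos : 0 < D := by positivity
  have hEpos : 0 < E := by positivity
  refine ⟨D * (2 * (q + 1)) ^ q + 2 ^ q * (D + E), by positivity, fun N hN z hz => ?_⟩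
  have hN' : (1 : ℝ) ≤ N := by exact_mod_cast hN
  have hN0 : (0 : ℝ) < N := by linarith
  set a : ℕ → ℝ := fun n => b n * K (n / N) with ha
  set G : ℝ := Real.exp (-(N * (1 - ‖z‖ ^ 2)) / 4) with hG
  have hG0 : 0 < G := Real.exp_pos _
  set F : ℂ := kernel b K N z
  have hF : F = ∑ n ∈ Finset.range (2 * N), (a n : ℂ) * z ^ n := rfl
  have ha_low : ∀ n : ℕ, 2 * n ≤ N → a n = 0 := fun n hn => by
    have : K (n / N) = 0 := hK1 _ (by
      rw [div_le_iff₀ hN0]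
      have : (2 : ℝ) * n ≤ N := by exact_mod_cast hn
      linarith)
    rw [ha]; simp only [this, mul_zero]
  have ha_high : ∀ n : ℕ, 2 * N ≤ n → a n = 0 := fun n hn => by
    have : K (n / N) = 0 := hK2 _ (by
      rw [le_div_iff₀ hN0]
      exact_mod_cast hn)
    rw [ha]; simp only [this, mul_zero]
  have hpow : (N : ℝ) ^ (α + 1) = N ^ α * N := Real.rpow_add_one hN0.ne' α
  have triv : ‖F‖ ≤ D * (N : ℝ) ^ (α + 1) * G := by
    have h : ∀ n ∈ Finset.range (2 * N), ‖(a n : ℂ) * z ^ n‖ ≤ C₀ * 3 ^ |α| * N ^ α * G := by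
      intro n hn
      rw [Finset.mem_range] at hn
      by_cases h2 : 2 * n ≤ N
      · rw [ha_low n h2]; simp only [Complex.ofReal_zero, zero_mul, norm_zero]; positivity
      · have h2' : (N : ℝ) ≤ 2 * n := by exact_mod_cast (not_le.1 h2).le
        rw [norm_mul, norm_pow, Complex.norm_real, Real.norm_eq_abs]
        have hn' : (n : ℝ) + 1 ≤ 2 * N := by exact_mod_cast hn
        have h3 := rpow_le_of_comparable (x := (n : ℝ) + 1) (y := N) (A := 3) α
          (by positivity) hN0 (by norm_num) (by linarith) (by linarith)
        have h4 : |a n| ≤ C₀ * 3 ^ |α| * N ^ α := by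
          refine (hbd₀ ⟨N, hN⟩ n).trans ?_
          rw [mul_assoc]
          exact mul_le_mul_of_nonneg_left h3 hC₀.le
        exact mul_le_mul h4 (norm_pow_le_exp hz h2') (by positivity) (by positivity)
    rw [hF]
    refine (norm_sum_le_of_le _ h).trans (le_of_eq ?_)
    rw [Finset.sum_const, Finset.card_range, nsmul_eq_mul, hpow, hD]
    push_cast
    ring
  rcases lt_or_ge N (2 * q) with hNq | hNq
  · -- only finitely many `N`: the weight is bounded
    have h1 : (1 + N * |z.im|) ^ q ≤ (2 * ((q : ℝ) + 1)) ^ q := by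
      have h2 : |z.im| ≤ 1 := (Complex.abs_im_le_norm z).trans hz
      have h3 : (N : ℝ) ≤ 2 * q := by exact_mod_cast hNq.le
      gcongr
      nlinarith [abs_nonneg z.im]
    calc ‖F‖ * (1 + N * |z.im|) ^ q
        ≤ (D * (N : ℝ) ^ (α + 1) * G) * (2 * ((q : ℝ) + 1)) ^ q :=
          mul_le_mul triv h1 (by positivity) (by positivity)
      _ = (D * (2 * (q + 1)) ^ q) * N ^ (α + 1) * G := by ring
      _ ≤ _ := by
        gcongr
        have : 0 < 2 ^ q * (D + E) := by positivity
        linarith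
  · -- here `N / 2 ≥ q`, so that the coefficients with `n < q` vanish, as summation by parts needs
    have parts : ‖F‖ * (N * |z.im|) ^ q ≤ E * (N : ℝ) ^ (α + 1) * G := by
      have h : ∀ n ∈ Finset.range (2 * N),
          ‖z ^ q * ((((fwdDiff 1)^[q] a n : ℝ) : ℂ) * z ^ n)‖ ≤
            C₁ * (A + 1) ^ |α - q| * N ^ (α - q) * G := by
        intro n hn
        rw [Finset.mem_range] at hn
        by_cases h2 : 2 * (n + q) ≤ N
        · rw [fwdDiff_iter_eq_zero fun k _ hk => ha_low k (by omega)]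
          simp only [Complex.ofReal_zero, zero_mul, mul_zero, norm_zero]
          positivity
        · have h2' : (N : ℝ) ≤ 2 * (n + q : ℕ) := by exact_mod_cast (not_le.1 h2).le
          have h5 : ‖z ^ q * ((((fwdDiff 1)^[q] a n : ℝ) : ℂ) * z ^ n)‖ =
              |(fwdDiff 1)^[q] a n| * ‖z‖ ^ (n + q) := by
            rw [norm_mul, norm_mul, norm_pow, norm_pow, Complex.norm_real, Real.norm_eq_abs,
              pow_add]
            ring
          rw [h5]
          have hn' : (n : ℝ) + 1 ≤ 2 * N := by exact_mod_cast hn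
          have hq0 : (0 : ℝ) ≤ q := by positivity
          have h6 : (N : ℝ) ≤ A * (n + 1) := by
            have h7 : (2 : ℝ) * q ≤ N := by exact_mod_cast hNq
            push_cast at h2'
            rw [hA]
            nlinarith [mul_nonneg hq0 (sub_nonneg.2 h7)]
          have h3 := rpow_le_of_comparable (x := (n : ℝ) + 1) (y := N) (A := A + 1) (α - q)
            (by positivity) hN0 (by linarith) (by nlinarith) (by nlinarith)
          have h4 : |(fwdDiff 1)^[q] a n| ≤ C₁ * (A + 1) ^ |α - q| * N ^ (α - q) := by
            refine (hbd₁ ⟨N, hN⟩ n).trans ?_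
            rw [mul_assoc]
            exact mul_le_mul_of_nonneg_left h3 hC₁.le
          exact mul_le_mul h4 (norm_pow_le_exp hz h2') (by positivity) (by positivity)
      have hsum : (1 - z) ^ q * F =
          ∑ n ∈ Finset.range (2 * N), z ^ q * ((((fwdDiff 1)^[q] a n : ℝ) : ℂ) * z ^ n) := by
        rw [hF, one_sub_pow_mul_sum (fun n hn => ha_low n (by omega)) ha_high, Finset.mul_sum]
      have hle := norm_sum_le_of_le _ h
      rw [← hsum, norm_mul, norm_pow, Finset.sum_const, Finset.card_range, nsmul_eq_mul] at hle
      have him : |z.im| ≤ ‖1 - z‖ := by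
        have := Complex.abs_im_le_norm (1 - z)
        simpa using this
      have hNq' : (N : ℝ) ^ (α - q) * N ^ q = N ^ α := by
        rw [← Real.rpow_natCast, ← Real.rpow_add hN0]; congr 1; ring
      calc ‖F‖ * (N * |z.im|) ^ q = (|z.im| ^ q * ‖F‖) * N ^ q := by rw [mul_pow]; ring
        _ ≤ (‖1 - z‖ ^ q * ‖F‖) * N ^ q := by gcongr
        _ ≤ (((2 * N : ℕ) : ℝ) * (C₁ * (A + 1) ^ |α - q| * N ^ (α - q) * G)) * N ^ q := by gcongr
        _ = E * (N ^ (α - q) * N ^ q) * N * G := by rw [hE]; push_cast; ring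
        _ = E * (N : ℝ) ^ (α + 1) * G := by rw [hNq', hpow]; ring
    have hsplit : (1 + N * |z.im|) ^ q ≤ 2 ^ q * (1 + (N * |z.im|) ^ q) := by
      have hnn : 0 ≤ N * |z.im| := by positivity
      have : (0 : ℝ) < 2 ^ q := by positivity
      rcases le_total (N * |z.im|) 1 with h | h
      · calc (1 + N * |z.im|) ^ q ≤ 2 ^ q := pow_le_pow_left₀ (by positivity) (by linarith) q
          _ ≤ _ := le_mul_of_one_le_right this.le (by have := pow_nonneg hnn q; linarith)
      · calc (1 + N * |z.im|) ^ q ≤ (2 * (N * |z.im|)) ^ q :=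
              pow_le_pow_left₀ (by positivity) (by linarith) q
          _ = 2 ^ q * (N * |z.im|) ^ q := mul_pow _ _ _
          _ ≤ _ := by gcongr; linarith
    calc ‖F‖ * (1 + N * |z.im|) ^ q ≤ ‖F‖ * (2 ^ q * (1 + (N * |z.im|) ^ q)) := by gcongr
      _ = 2 ^ q * (‖F‖ + ‖F‖ * (N * |z.im|) ^ q) := by ring
      _ ≤ 2 ^ q * (D * (N : ℝ) ^ (α + 1) * G + E * (N : ℝ) ^ (α + 1) * G) := by gcongr
      _ = (2 ^ q * (D + E)) * N ^ (α + 1) * G := by ring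
      _ ≤ _ := by
        gcongr
        have : 0 < D * (2 * ((q : ℝ) + 1)) ^ q := by positivity
        linarith

/-- At the point `z = 1`, where all terms have the same sign, the kernel has its full size. -/
theorem sum_lower_bound {K : ℝ → ℝ} (hK : Continuous K) (hK0 : ∀ t, 0 ≤ K t) (hK1 : 0 < K 1)
    {b : ℕ → ℝ} {α c : ℝ} (hα : 0 ≤ α) (hc : 0 < c) (hb : ∀ n : ℕ, c * ((n : ℝ) + 1) ^ α ≤ b n) :
    ∃ C : ℝ, 0 < C ∧ ∀ N : ℕ, 1 ≤ N →
      C * (N : ℝ) ^ (α + 1) ≤ ∑ n ∈ Finset.range (2 * N), b n * K (n / N) := by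
  obtain ⟨δ, hδ, hball⟩ := Metric.continuousAt_iff.1 hK.continuousAt (K 1 / 2) (by linarith)
  set ε : ℝ := min (δ / 2) (1 / 2) with hε
  have hε0 : 0 < ε := by positivity
  have hlow : ∀ t, 1 ≤ t → t ≤ 1 + ε → K 1 / 2 ≤ K t := fun t h1 h2 => by
    have h3 : dist t 1 < δ := by
      rw [Real.dist_eq, abs_of_nonneg (by linarith)]
      have := min_le_left (δ / 2) (1 / 2)
      linarith
    have := (abs_lt.1 (hball h3)).1
    linarith
  have hbpos : ∀ n, 0 ≤ b n := fun n => le_trans (by positivity) (hb n)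
  refine ⟨ε * (c * (K 1 / 2)), by positivity, fun N hN => ?_⟩
  have hN' : (1 : ℝ) ≤ N := by exact_mod_cast hN
  have hN0 : (0 : ℝ) < N := by linarith
  set L := ⌊ε * N⌋₊ with hL
  have hLle : (L : ℝ) ≤ ε * N := Nat.floor_le (by positivity)
  have hLlt : ε * N ≤ L + 1 := (Nat.lt_floor_add_one _).le
  have hL2 : L < N := by
    have h1 : ε ≤ 1 / 2 := min_le_right _ _
    have : (L : ℝ) < N := by nlinarith
    exact_mod_cast this
  have hterm : ∀ n ∈ Finset.Icc N (N + L), c * N ^ α * (K 1 / 2) ≤ b n * K (n / N) := by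
    intro n hn
    rw [Finset.mem_Icc] at hn
    have h1 : (N : ℝ) ≤ n := by exact_mod_cast hn.1
    have h2 : (n : ℝ) ≤ N + L := by exact_mod_cast hn.2
    refine mul_le_mul ?_ (hlow _ ?_ ?_) (by positivity) (hbpos n)
    · refine le_trans ?_ (hb n)
      gcongr
      linarith
    · rwa [le_div_iff₀ hN0, one_mul]
    · rw [div_le_iff₀ hN0]; linarith
  calc ε * (c * (K 1 / 2)) * (N : ℝ) ^ (α + 1)
      = (ε * N) * (c * N ^ α * (K 1 / 2)) := by rw [Real.rpow_add_one hN0.ne']; ring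
    _ ≤ (L + 1) * (c * N ^ α * (K 1 / 2)) := by gcongr
    _ = ∑ n ∈ Finset.Icc N (N + L), c * N ^ α * (K 1 / 2) := by
      rw [Finset.sum_const, Nat.card_Icc, nsmul_eq_mul]
      congr 1
      rw [show N + L + 1 - N = L + 1 by omega]
      push_cast
      ring
    _ ≤ ∑ n ∈ Finset.Icc N (N + L), b n * K (n / N) := Finset.sum_le_sum hterm
    _ ≤ _ := by
      refine Finset.sum_le_sum_of_subset_of_nonneg (fun n hn => ?_) fun n _ _ =>
        mul_nonneg (hbpos n) (hK0 _)
      rw [Finset.mem_Icc] at hn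
      rw [Finset.mem_range]
      omega

theorem half_le_re_pow {z : ℂ} (hz : ‖z‖ ≤ 1) {n N : ℕ} (hn : n ≤ 2 * N)
    (h : 4 * N * ‖z - 1‖ ≤ 1) : 1 / 2 ≤ (z ^ n).re := by
  have key : ∀ k : ℕ, ‖z ^ k - 1‖ ≤ k * ‖z - 1‖ := by
    intro k
    induction k with
    | zero => simp
    | succ k ih =>
      calc ‖z ^ (k + 1) - 1‖ = ‖z * (z ^ k - 1) + (z - 1)‖ := by congr 1; ring
        _ ≤ ‖z‖ * ‖z ^ k - 1‖ + ‖z - 1‖ := (norm_add_le _ _).trans (by rw [norm_mul])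
        _ ≤ 1 * (k * ‖z - 1‖) + ‖z - 1‖ := by gcongr
        _ = _ := by push_cast; ring
  have h1 := key n
  have h2 : (n : ℝ) ≤ 2 * N := by exact_mod_cast hn
  have h3 := (abs_le.1 (Complex.abs_re_le_norm (z ^ n - 1))).1
  rw [Complex.sub_re, Complex.one_re] at h3
  nlinarith [mul_le_mul_of_nonneg_right h2 (norm_nonneg (z - 1))]

/-! ### The normalized surface measure -/

/-- The radial projection `x ↦ x / |x|` onto the sphere, with the value `e` at the origin. -/
noncomputable def radialProj {d : ℕ} (e : Sph d) (x : EuclideanSpace ℝ (Fin d)) : Sph d :=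
  ⟨if x = 0 then e.1 else ‖x‖⁻¹ • x, by
    split_ifs with h
    · exact e.2
    · simp [norm_smul, h]⟩

theorem measurable_radialProj {d : ℕ} (e : Sph d) : Measurable (radialProj e) := by
  refine Measurable.subtype_mk (Measurable.ite ?_ measurable_const ?_)
  · exact measurableSet_singleton _
  · exact measurable_norm.inv.smul measurable_id

theorem radialProj_apply {d : ℕ} (e : Sph d) {x : EuclideanSpace ℝ (Fin d)} (hx : x ≠ 0)
    (i : Fin d) : (radialProj e x).1 i = x i / ‖x‖ := by
  simp [radialProj, hx, div_eq_inv_mul]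

theorem toSphere_eq_map_radialProj {d : ℕ} (e : Sph d) :
    (volume : Measure (EuclideanSpace ℝ (Fin d))).toSphere =
      (d : ENNReal) • ((volume.restrict (Metric.ball 0 1 \ {0})).map (radialProj e)) := by
  ext s hs
  rw [Measure.toSphere_apply' _ hs, Measure.smul_apply,
    Measure.map_apply (measurable_radialProj e) hs,
    Measure.restrict_apply (measurable_radialProj e hs), finrank_euclideanSpace_fin, smul_eq_mul]
  congr 2
  ext x
  simp only [Set.mem_smul, Set.mem_image, Set.mem_inter_iff, Set.mem_preimage, Set.mem_sdiff,
    Metric.mem_ball, dist_zero_right, Set.mem_singleton_iff]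
  constructor
  · rintro ⟨r, ⟨hr0, hr1⟩, y, ⟨η, hη, rfl⟩, rfl⟩
    have hn : ‖η.1‖ = 1 := by simp
    have h0 : r • η.1 ≠ 0 := by
      rw [← norm_ne_zero_iff, norm_smul, hn, mul_one]; simpa using hr0.ne'
    refine ⟨?_, ?_, h0⟩
    · have : radialProj e (r • η.1) = η := by
        apply Subtype.ext
        simp only [radialProj, h0, if_false, norm_smul, hn, mul_one, Real.norm_eq_abs,
          abs_of_pos hr0, smul_smul]
        rw [inv_mul_cancel₀ hr0.ne', one_smul]
      rwa [this]
    · rw [norm_smul, hn, mul_one, Real.norm_eq_abs, abs_of_pos hr0]; exact hr1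
  · rintro ⟨h1, h2, h0⟩
    have hx : ‖x‖ ≠ 0 := norm_ne_zero_iff.2 h0
    refine ⟨‖x‖, ⟨norm_pos_iff.2 h0, h2⟩, (radialProj e x).1, ⟨_, h1, rfl⟩, ?_⟩
    simp only [radialProj, h0, if_false, smul_smul]
    rw [mul_inv_cancel₀ hx, one_smul]

theorem toSphere_univ_ne_zero {d : ℕ} (hd : 1 ≤ d) :
    (volume : Measure (EuclideanSpace ℝ (Fin d))).toSphere Set.univ ≠ 0 := by
  have : Nonempty (Fin d) := ⟨⟨0, hd⟩⟩
  rw [Ne, Measure.measure_univ_eq_zero]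
  exact Measure.toSphere_ne_zero _

/-- The measure on the sphere is the image of Lebesgue measure on the unit ball under the radial
projection, up to a constant. -/
theorem exists_sphMeasure_eq {d : ℕ} (hd : 1 ≤ d) (e : Sph d) :
    ∃ c : ℝ, 0 < c ∧ sphMeasure d =
      ENNReal.ofReal c • ((volume.restrict (Metric.ball 0 1 \ {0})).map (radialProj e)) := by
  set T := (volume : Measure (EuclideanSpace ℝ (Fin d))).toSphere Set.univ with hT
  have h0 : T ≠ 0 := toSphere_univ_ne_zero hd
  have h1 : T ≠ ⊤ := measure_ne_top _ _
  have h2 : T⁻¹ * d ≠ ⊤ := ENNReal.mul_ne_top (ENNReal.inv_ne_top.2 h0) (by simp)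
  have h3 : T⁻¹ * d ≠ 0 := mul_ne_zero (ENNReal.inv_ne_zero.2 h1) (by simp; omega)
  refine ⟨(T⁻¹ * d).toReal, ENNReal.toReal_pos h3 h2, ?_⟩
  rw [ENNReal.ofReal_toReal h2, sphMeasure, ← hT, toSphere_eq_map_radialProj e, smul_smul]

instance isProbabilityMeasure_sphMeasure {d : ℕ} [NeZero d] :
    IsProbabilityMeasure (sphMeasure d) := by
  refine ⟨?_⟩
  rw [sphMeasure, Measure.smul_apply, smul_eq_mul]
  exact ENNReal.inv_mul_cancel (toSphere_univ_ne_zero (NeZero.one_le)) (measure_ne_top _ _)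

/-- The last two coordinates of a point of `𝕊^{D+1}`, as the complex number
`η_{D+2} + i η_{D+1}`. -/
noncomputable def planePart {D : ℕ} (η : Sph (D + 2)) : ℂ :=
  ⟨η.1 (Fin.last (D + 1)), η.1 (Fin.last D).castSucc⟩

theorem continuous_planePart {D : ℕ} : Continuous (planePart (D := D)) := by
  have h : (planePart (D := D)) = fun η => Complex.equivRealProdCLM.symm
      (η.1 (Fin.last (D + 1)), η.1 (Fin.last D).castSucc) := by
    funext η; rfl
  rw [h]
  fun_prop

theorem sq_norm_split {D : ℕ} (x : EuclideanSpace ℝ (Fin (D + 2))) :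
    ‖x‖ ^ 2 = ∑ i : Fin D, x i.castSucc.castSucc ^ 2 + x (Fin.last D).castSucc ^ 2
      + x (Fin.last (D + 1)) ^ 2 := by
  rw [EuclideanSpace.real_norm_sq_eq, Fin.sum_univ_castSucc, Fin.sum_univ_castSucc]

theorem sq_norm_planePart {D : ℕ} (η : Sph (D + 2)) :
    ‖planePart η‖ ^ 2 = 1 - ∑ i : Fin D, η.1 i.castSucc.castSucc ^ 2 := by
  have h := sq_norm_split η.1
  have h1 : ‖η.1‖ = 1 := by simp
  rw [h1] at h
  rw [← Complex.normSq_eq_norm_sq, Complex.normSq_apply, planePart]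
  linarith

theorem norm_planePart_le {D : ℕ} (η : Sph (D + 2)) : ‖planePart η‖ ≤ 1 := by
  have h := sq_norm_planePart η
  have : 0 ≤ ∑ i : Fin D, η.1 i.castSucc.castSucc ^ 2 := Finset.sum_nonneg fun _ _ => sq_nonneg _
  nlinarith [norm_nonneg (planePart η)]

theorem integral_one_add_mul_rpow (s : ℝ) {N : ℝ} (hN : 0 < N) :
    ∫ t : ℝ, (1 + N * |t|) ^ (-s) = N⁻¹ * ∫ t : ℝ, (1 + |t|) ^ (-s) := by
  have := Measure.integral_comp_mul_left (fun t : ℝ => (1 + |t|) ^ (-s)) N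
  simpa [abs_mul, abs_of_pos hN] using this

theorem integrable_one_add_mul_rpow {s N : ℝ} (hs : 1 < s) (hN : 0 < N) :
    Integrable (fun t : ℝ => (1 + N * |t|) ^ (-s)) := by
  have h := integrable_one_add_norm (E := ℝ) (μ := volume) (r := s) (by simpa using hs)
  have := h.comp_mul_left' hN.ne'
  simpa [abs_mul, abs_of_pos hN] using this

/-- The majorant of the kernels: along the sphere it lives at scale `1 / N` in one direction and at
scale `1 / √N` in `d - 2` directions. The radial extension to the unit ball is dominated by a
product of functions of one variable. -/
theorem lintegral_majorant_le (D : ℕ) {s lam : ℝ} (hs : 1 < s) (hlam : 0 < lam) :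
    ∃ C : ℝ, 0 < C ∧ ∀ N : ℝ, 0 < N →
      ∫⁻ η, ENNReal.ofReal ((1 + N * |(planePart η).im|) ^ (-s) *
          Real.exp (-(lam * N * (1 - ‖planePart η‖ ^ 2)))) ∂(sphMeasure (D + 2)) ≤
        ENNReal.ofReal (C * N ^ (-(((D + 2 : ℕ) : ℝ) / 2))) := by
  obtain ⟨c, hc, hmeas⟩ := exists_sphMeasure_eq (d := D + 2) (by omega) (basisPoint 0)
  set I : ℝ := ∫ t : ℝ, (1 + |t|) ^ (-s) with hI
  have hI0 : 0 ≤ I := integral_nonneg fun t => by positivity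
  refine ⟨c * (√(Real.pi / lam) ^ D * (I + 1) * 2), by positivity, fun N hN => ?_⟩
  let f : Fin (D + 2) → ℝ → ℝ := Fin.snoc (α := fun _ => ℝ → ℝ)
    (Fin.snoc (α := fun _ => ℝ → ℝ) (fun _ t => Real.exp (-(lam * N) * t ^ 2))
      (fun t => (1 + N * |t|) ^ (-s)))
    (Set.indicator (Set.Icc (-1) 1) fun _ => 1)
  have hf2 : f (Fin.last (D + 1)) = Set.indicator (Set.Icc (-1) 1) fun _ => 1 := by simp [f]
  have hf1 : f (Fin.last D).castSucc = fun t => (1 + N * |t|) ^ (-s) := by simp [f]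
  have hf0 : ∀ i : Fin D, f i.castSucc.castSucc = fun t => Real.exp (-(lam * N) * t ^ 2) :=
    fun i => by simp [f]
  have hf_nonneg : ∀ i t, 0 ≤ f i t := by
    intro i
    refine Fin.lastCases ?_ (fun i => Fin.lastCases ?_ (fun i => ?_) i) i
    · intro t; rw [hf2]; exact Set.indicator_nonneg (fun _ _ => zero_le_one) t
    · intro t; rw [hf1]; positivity
    · intro t; rw [hf0]; positivity
  have hf_int : ∀ i, Integrable (f i) := by
    refine Fin.lastCases ?_ (fun i => Fin.lastCases ?_ (fun i => ?_) i)
    · rw [hf2]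
      exact (integrable_indicator_iff measurableSet_Icc).2 (integrableOn_const (by simp) (by simp))
    · rw [hf1]; exact integrable_one_add_mul_rpow hs hN
    · rw [hf0]; exact integrable_exp_neg_mul_sq (by positivity)
  have hprod_int : Integrable (fun x : Fin (D + 2) → ℝ => ∏ i, f i (x i)) :=
    Integrable.fintype_prod (f := f) hf_int
  have hG : Measurable fun η : Sph (D + 2) => ENNReal.ofReal
      ((1 + N * |(planePart η).im|) ^ (-s) *
          Real.exp (-(lam * N * (1 - ‖planePart η‖ ^ 2)))) := by
    have := (continuous_planePart (D := D)).measurable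
    fun_prop
  rw [hmeas, lintegral_smul_measure, lintegral_map hG (measurable_radialProj _), smul_eq_mul]
  have hpt : ∀ x ∈ (Metric.ball 0 1 \ {0} : Set (EuclideanSpace ℝ (Fin (D + 2)))),
      ENNReal.ofReal ((1 + N * |(planePart (radialProj (basisPoint 0) x)).im|) ^ (-s) *
          Real.exp (-(lam * N * (1 - ‖planePart (radialProj (basisPoint 0) x)‖ ^ 2)))) ≤
        ENNReal.ofReal (∏ i, f i (x.ofLp i)) := by
    rintro x ⟨hx1, hx0⟩
    have hx0' : x ≠ 0 := hx0
    have hxpos : 0 < ‖x‖ := norm_pos_iff.2 hx0'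
    have hxlt : ‖x‖ ≤ 1 := by simpa using (Metric.mem_ball.1 hx1).le
    have hge : ∀ i, |x i| ≤ |(radialProj (basisPoint 0) x).1 i| := fun i => by
      rw [radialProj_apply _ hx0', abs_div, abs_norm, le_div_iff₀ hxpos]
      exact mul_le_of_le_one_right (abs_nonneg _) hxlt
    apply ENNReal.ofReal_le_ofReal
    rw [Fin.prod_univ_castSucc, Fin.prod_univ_castSucc, hf2, hf1]
    simp only [hf0]
    have h3 : x.ofLp (Fin.last (D + 1)) ∈ Set.Icc (-1 : ℝ) 1 := by
      rw [Set.mem_Icc, ← abs_le]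
      have := PiLp.norm_apply_le x (Fin.last (D + 1))
      rw [Real.norm_eq_abs] at this
      linarith
    rw [Set.indicator_of_mem h3, mul_one, ← Real.exp_sum, mul_comm]
    refine mul_le_mul ?_ ?_ (by positivity) (by positivity)
    · apply Real.exp_le_exp.2
      rw [sq_norm_planePart, ← Finset.mul_sum]
      have : ∑ i : Fin D, x i.castSucc.castSucc ^ 2 ≤
          ∑ i : Fin D, (radialProj (basisPoint 0) x).1 i.castSucc.castSucc ^ 2 :=
        Finset.sum_le_sum fun i _ => sq_le_sq.2 (hge _)
      nlinarith [mul_le_mul_of_nonneg_left this (mul_pos hlam hN).le]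
    · refine Real.rpow_le_rpow_of_nonpos (by positivity) ?_ (by linarith)
      have := hge (Fin.last D).castSucc
      exact add_le_add le_rfl (mul_le_mul_of_nonneg_left this hN.le)
  have hball : MeasurableSet (Metric.ball 0 1 \ {0} : Set (EuclideanSpace ℝ (Fin (D + 2)))) :=
    measurableSet_ball.diff (measurableSet_singleton _)
  refine (mul_le_mul_right (setLIntegral_mono' hball hpt) (ENNReal.ofReal c)).trans ?_
  calc ENNReal.ofReal c * ∫⁻ x in (Metric.ball 0 1 \ {0} : Set (EuclideanSpace ℝ (Fin (D + 2)))),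
          ENNReal.ofReal (∏ i, f i (x.ofLp i))
      ≤ ENNReal.ofReal c *
          ∫⁻ x : EuclideanSpace ℝ (Fin (D + 2)), ENNReal.ofReal (∏ i, f i (x.ofLp i)) := by
        gcongr
        exact Measure.restrict_le_self
    _ = ENNReal.ofReal c * ∫⁻ x : Fin (D + 2) → ℝ, ENNReal.ofReal (∏ i, f i (x i)) := by
        congr 1
        exact (PiLp.volume_preserving_ofLp (Fin (D + 2))).lintegral_comp_emb
          (MeasurableEquiv.toLp 2 (Fin (D + 2) → ℝ)).symm.measurableEmbedding
          (fun y => ENNReal.ofReal (∏ i, f i (y i)))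
    _ = ENNReal.ofReal c * ENNReal.ofReal (∏ i, ∫ t, f i t) := by
        rw [← ofReal_integral_eq_lintegral_ofReal hprod_int
          (Filter.Eventually.of_forall fun x => Finset.prod_nonneg fun i _ => hf_nonneg i _),
          integral_fintype_prod_volume_eq_prod]
    _ ≤ ENNReal.ofReal (c * (√(Real.pi / lam) ^ D * (I + 1) * 2) *
          N ^ (-(((D + 2 : ℕ) : ℝ) / 2))) := by
        rw [← ENNReal.ofReal_mul hc.le]
        apply ENNReal.ofReal_le_ofReal
        rw [mul_assoc c]
        refine mul_le_mul_of_nonneg_left ?_ hc.le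
        rw [Fin.prod_univ_castSucc, Fin.prod_univ_castSucc, hf2, hf1]
        simp only [hf0]
        have hI2 : ∫ t : ℝ, Set.indicator (Set.Icc (-1) 1) (fun _ => (1 : ℝ)) t = 2 := by
          rw [integral_indicator measurableSet_Icc]; simp; norm_num
        rw [hI2, integral_one_add_mul_rpow s hN, integral_gaussian, Finset.prod_const,
          Finset.card_univ, Fintype.card_fin]
        have hN2 : √(Real.pi / (lam * N)) ^ D * N⁻¹ =
            √(Real.pi / lam) ^ D * N ^ (-(((D + 2 : ℕ) : ℝ) / 2)) := by
          rw [← div_div, Real.sqrt_div' _ hN.le, div_pow, div_eq_mul_inv, mul_assoc]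
          congr 1
          rw [Real.sqrt_eq_rpow, ← Real.rpow_natCast, ← Real.rpow_mul hN.le, ← mul_inv,
            ← Real.rpow_add_one hN.ne', ← Real.rpow_neg hN.le]
          congr 1
          push_cast
          ring
        calc √(Real.pi / (lam * N)) ^ D * (N⁻¹ * I) * 2
            = (√(Real.pi / (lam * N)) ^ D * N⁻¹) * I * 2 := by ring
          _ = √(Real.pi / lam) ^ D * I * 2 * N ^ (-(((D + 2 : ℕ) : ℝ) / 2)) := by rw [hN2]; ring
          _ ≤ _ := by gcongr; linarith

theorem radial_box_estimate {N δ S u v ρ : ℝ} (hN : 0 < N) (hδ0 : 0 < δ) (hδ1 : δ ≤ 1 / 16)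
    (hS : 0 ≤ S) (hSu : S + u ^ 2 ≤ δ / 16 / N) (hSu1 : S + u ^ 2 ≤ 1 / 256) (hu : |u| ≤ δ / N)
    (hv : 1 / 2 ≤ v) (hv' : v ≤ 3 / 4) (hρ : 0 ≤ ρ) (hnorm : ρ ^ 2 = S + u ^ 2 + v ^ 2) :
    ρ < 1 ∧ 0 < ρ ∧ |v / ρ - 1| ≤ 2 * (δ / 16 / N) ∧ |u / ρ| ≤ 2 * (δ / N) := by
  have hρv : v ≤ ρ := abs_le_of_sq_le_sq' (by nlinarith [sq_nonneg u]) hρ |>.2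
  have hρ1 : ρ < 1 := abs_lt_of_sq_lt_sq' (by nlinarith) zero_le_one |>.2
  have hρpos : 0 < ρ := by linarith
  have hδN : 0 ≤ δ / N := by positivity
  refine ⟨hρ1, hρpos, ?_, ?_⟩
  · rw [abs_sub_comm, abs_of_nonneg (by rw [sub_nonneg, div_le_one hρpos]; exact hρv),
      one_sub_div hρpos.ne', div_le_iff₀ hρpos]
    have h6 : (ρ - v) * (ρ + v) = S + u ^ 2 := by linear_combination hnorm
    have h7 : ρ - v ≤ (ρ - v) * (ρ + v) := le_mul_of_one_le_right (sub_nonneg.2 hρv) (by linarith)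
    have h8 : 0 ≤ δ / 16 / N := by positivity
    have h9 : δ / 16 / N * 1 ≤ δ / 16 / N * (2 * ρ) := mul_le_mul_of_nonneg_left (by linarith) h8
    linarith
  · rw [abs_div, abs_of_pos hρpos, div_le_iff₀ hρpos]
    have h9 : δ / N * 1 ≤ δ / N * (2 * ρ) := mul_le_mul_of_nonneg_left (by linarith) hδN
    linarith

/-- The set on which `planePart` is within `1 / (4 N)` of `1` contains the radial projection of a
box with one side of length `~ 1`, one of length `~ 1 / N`, and `d - 2` of length `~ 1 / √N`. -/
theorem sphMeasure_near_one_ge (D : ℕ) :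
    ∃ C : ℝ, 0 < C ∧ ∀ N : ℝ, 1 ≤ N →
      ENNReal.ofReal (C * N ^ (-(((D + 2 : ℕ) : ℝ) / 2))) ≤
        sphMeasure (D + 2) {η | 4 * N * ‖planePart η - 1‖ ≤ 1} := by
  obtain ⟨c, hc, hmeas⟩ := exists_sphMeasure_eq (d := D + 2) (by omega) (basisPoint 0)
  set δ : ℝ := 1 / (16 * (D + 1)) with hδ
  have hδ0 : 0 < δ := by positivity
  have hδD : (D + 1) * δ = 1 / 16 := by rw [hδ]; field_simp
  have hδ1 : δ ≤ 1 / 16 := by nlinarith [(by positivity : (0 : ℝ) ≤ D)]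
  have hδ2 : (D + 1) * δ ^ 2 = δ / 16 := by rw [pow_two, ← mul_assoc, hδD]; ring
  refine ⟨c * ((2 * δ) ^ D * (2 * δ) * (1 / 4)), by positivity, fun N hN => ?_⟩
  have hN0 : 0 < N := by linarith
  have hR : MeasurableSet {η : Sph (D + 2) | 4 * N * ‖planePart η - 1‖ ≤ 1} := by
    apply IsClosed.measurableSet
    have := continuous_planePart (D := D)
    exact isClosed_le (by fun_prop) continuous_const
  rw [hmeas, Measure.smul_apply, Measure.map_apply (measurable_radialProj _) hR,
    Measure.restrict_apply (measurable_radialProj _ hR), smul_eq_mul]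
  let B : Fin (D + 2) → Set ℝ := Fin.snoc (α := fun _ => Set ℝ)
    (Fin.snoc (α := fun _ => Set ℝ) (fun _ => Set.Icc (-(δ / √N)) (δ / √N))
      (Set.Icc (-(δ / N)) (δ / N)))
    (Set.Icc (1 / 2) (3 / 4))
  have hB2 : B (Fin.last (D + 1)) = Set.Icc (1 / 2) (3 / 4) := by simp [B]
  have hB1 : B (Fin.last D).castSucc = Set.Icc (-(δ / N)) (δ / N) := by simp [B]
  have hB0 : ∀ i : Fin D, B i.castSucc.castSucc = Set.Icc (-(δ / √N)) (δ / √N) :=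
    fun i => by simp [B]
  have hvol : volume ((WithLp.ofLp : EuclideanSpace ℝ (Fin (D + 2)) → _) ⁻¹' Set.univ.pi B) =
      ENNReal.ofReal ((2 * δ) ^ D * (2 * δ) * (1 / 4) * N ^ (-(((D + 2 : ℕ) : ℝ) / 2))) := by
    have hBm : MeasurableSet (Set.univ.pi B) := by
      refine MeasurableSet.univ_pi
        (Fin.lastCases ?_ (fun i => Fin.lastCases ?_ (fun i => ?_) i))
      · rw [hB2]; exact measurableSet_Icc
      · rw [hB1]; exact measurableSet_Icc
      · rw [hB0]; exact measurableSet_Icc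
    rw [(PiLp.volume_preserving_ofLp (Fin (D + 2))).measure_preimage hBm.nullMeasurableSet,
      volume_pi_pi,
      Fin.prod_univ_castSucc, Fin.prod_univ_castSucc, hB2, hB1]
    simp only [hB0, Real.volume_Icc]
    rw [Finset.prod_const, Finset.card_univ, Fintype.card_fin, ← ENNReal.ofReal_pow (by
        have : 0 ≤ δ / √N := by positivity
        linarith), ← ENNReal.ofReal_mul (by
        have : 0 ≤ δ / √N := by positivity
        exact pow_nonneg (by linarith) _), ← ENNReal.ofReal_mul (by
        have : 0 ≤ δ / √N := by positivity
        have : 0 ≤ δ / N := by positivity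
        exact mul_nonneg (pow_nonneg (by linarith) _) (by linarith))]
    congr 1
    have hN2 : (1 / √N) ^ D * (1 / N) = N ^ (-(((D + 2 : ℕ) : ℝ) / 2)) := by
      rw [Real.sqrt_eq_rpow, div_pow, one_pow, one_div (_ ^ D), one_div N, ← Real.rpow_natCast,
        ← Real.rpow_mul hN0.le, ← mul_inv, ← Real.rpow_add_one hN0.ne', ← Real.rpow_neg hN0.le]
      congr 1
      push_cast
      ring
    rw [← hN2, show δ / √N - -(δ / √N) = (2 * δ) * (1 / √N) by ring, mul_pow]
    ring
  have hsub : ((WithLp.ofLp : EuclideanSpace ℝ (Fin (D + 2)) → _) ⁻¹' Set.univ.pi B) ⊆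
      radialProj (basisPoint 0) ⁻¹' {η : Sph (D + 2) | 4 * N * ‖planePart η - 1‖ ≤ 1} ∩
        (Metric.ball 0 1 \ {0}) := by
    intro x hx
    rw [Set.mem_preimage, Set.mem_univ_pi] at hx
    have h2 := hx (Fin.last (D + 1))
    have h1 := hx (Fin.last D).castSucc
    have h0 : ∀ i : Fin D, x i.castSucc.castSucc ^ 2 ≤ δ ^ 2 / N := fun i => by
      have := hx i.castSucc.castSucc
      rw [hB0, Set.mem_Icc, ← abs_le] at this
      rw [← Real.sq_sqrt hN0.le, ← div_pow]
      exact sq_le_sq.2 (this.trans (le_abs_self _))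
    rw [hB2, Set.mem_Icc] at h2
    rw [hB1, Set.mem_Icc, ← abs_le] at h1
    set u := x (Fin.last D).castSucc with hu
    set v := x (Fin.last (D + 1)) with hv
    set S := ∑ i : Fin D, x i.castSucc.castSucc ^ 2 with hS
    have hnorm : ‖x‖ ^ 2 = S + u ^ 2 + v ^ 2 := sq_norm_split x
    have hS0 : 0 ≤ S := Finset.sum_nonneg fun _ _ => sq_nonneg _
    have hS1 : S ≤ D * (δ ^ 2 / N) := by
      refine (Finset.sum_le_sum fun i _ => h0 i).trans (le_of_eq ?_)
      simp
    have hu2 : u ^ 2 ≤ δ ^ 2 / N := by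
      have h3 : u ^ 2 ≤ (δ / N) ^ 2 := sq_le_sq.2 (h1.trans (le_abs_self _))
      refine h3.trans ?_
      rw [div_pow]
      gcongr
      nlinarith
    have hSu : S + u ^ 2 ≤ δ / 16 / N := by
      calc S + u ^ 2 ≤ D * (δ ^ 2 / N) + δ ^ 2 / N := add_le_add hS1 hu2
        _ = ((D + 1) * δ ^ 2) / N := by ring
        _ = _ := by rw [hδ2]
    have hSu1 : S + u ^ 2 ≤ 1 / 256 := by
      refine hSu.trans ?_
      rw [div_le_iff₀ hN0]
      linarith
    set ρ := ‖x‖ with hρ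
    have hρ0 : 0 ≤ ρ := norm_nonneg x
    obtain ⟨hρ1, hρpos, h5, h4⟩ :=
      radial_box_estimate hN0 hδ0 hδ1 hS0 hSu hSu1 h1 h2.1 h2.2 hρ0 hnorm
    have hx0 : x ≠ 0 := norm_pos_iff.1 hρpos
    refine ⟨?_, by simpa using hρ1, hx0⟩
    set z := planePart (radialProj (basisPoint 0) x) with hz
    have hre : z.re = v / ρ := radialProj_apply _ hx0 _
    have him : z.im = u / ρ := radialProj_apply _ hx0 _
    have hbound : ‖z - 1‖ ≤ |v / ρ - 1| + |u / ρ| := by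
      have := Complex.norm_le_abs_re_add_abs_im (z - 1)
      simpa [hre, him] using this
    change 4 * N * ‖z - 1‖ ≤ 1
    calc 4 * N * ‖z - 1‖ ≤ 4 * N * (2 * (δ / 16 / N) + 2 * (δ / N)) := by
          gcongr; linarith
      _ = 8 * (δ / 16 + δ) := by field_simp; ring
      _ ≤ 1 := by linarith
  calc _ = ENNReal.ofReal c *
        ENNReal.ofReal ((2 * δ) ^ D * (2 * δ) * (1 / 4) * N ^ (-(((D + 2 : ℕ) : ℝ) / 2))) := by
        rw [← ENNReal.ofReal_mul hc.le]; congr 1; ring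
    _ ≤ _ := by rw [← hvol]; gcongr

/-! ### The extreme multi-indices and the planar form of the curvelets -/

theorem idx_zero (d n : ℕ) (k : Fin (d - 2) → ℤ) : idx d n k 0 = n := rfl

theorem idx_succ {d n : ℕ} (k : Fin (d - 2) → ℤ) {j : ℕ} (hj : j < d - 2) :
    idx d n k (j + 1) = k ⟨j, hj⟩ := by
  simp [idx, hj]

theorem coe_absIdx (d n : ℕ) (k : Fin (d - 2) → ℤ) (j : ℕ) :
    (absIdx d n k j : ℤ) = |idx d n k j| := Int.natCast_natAbs _

theorem absIdx_antitone {d n : ℕ} {k : Fin (d - 2) → ℤ}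
    (h : ∀ j < d - 2, (absIdx d n k (j + 1) : ℤ) ≤ idx d n k j) {i j : ℕ} (hij : i ≤ j)
    (hj : j ≤ d - 2) : absIdx d n k j ≤ absIdx d n k i := by
  induction j, hij using Nat.le_induction with
  | base => exact le_rfl
  | succ j hij ih =>
    refine le_trans ?_ (ih (by omega))
    have h1 := h j (by omega)
    have h2 := le_abs_self (idx d n k j)
    rw [← coe_absIdx] at h2
    omega

/-- The box in the definition of `indexSet` is no restriction. -/
theorem mem_indexSet {d n : ℕ} {k : Fin (d - 2) → ℤ} :
    k ∈ indexSet d n ↔ (∀ j < d - 2, 0 ≤ idx d n k j) ∧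
      ∀ j < d - 2, (absIdx d n k (j + 1) : ℤ) ≤ idx d n k j := by
  refine Finset.mem_filter.trans ⟨fun h => h.2, fun h => ⟨?_, h⟩⟩
  rw [Fintype.mem_piFinset]
  rintro ⟨j, hj⟩
  have h1 := absIdx_antitone h.2 (Nat.zero_le (j + 1)) (by omega)
  have h2 : absIdx d n k 0 = n := by simp [absIdx, idx_zero]
  rw [h2] at h1
  have h3 := coe_absIdx d n k (j + 1)
  rw [idx_succ k hj] at h3
  rw [Finset.mem_Icc, ← abs_le]
  omega

/-- The multi-index `(n, …, n, e)`. -/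
def extremeIndex (d n : ℕ) (e : ℤ) : Fin (d - 2) → ℤ :=
  fun i => if (i : ℕ) + 3 = d then e else n

theorem idx_extremeIndex {d n : ℕ} {e : ℤ} {j : ℕ} (hj : j < d - 2) :
    idx d n (extremeIndex d n e) j = n := by
  cases j with
  | zero => rfl
  | succ j => rw [idx_succ _ (by omega), extremeIndex, if_neg (by simp only; omega)]

theorem idx_extremeIndex_last {d n : ℕ} (hd : 3 ≤ d) (e : ℤ) :
    idx d n (extremeIndex d n e) (d - 2) = e := by
  obtain ⟨j, hj⟩ : ∃ j, d - 2 = j + 1 := ⟨d - 3, by omega⟩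
  conv_lhs => arg 4; rw [hj]
  rw [idx_succ _ (by omega), extremeIndex, if_pos (by simp only; omega)]

theorem absIdx_extremeIndex {d n : ℕ} (hd : 3 ≤ d) {e : ℤ} (he : e.natAbs = n) {j : ℕ}
    (hj : j ≤ d - 2) : absIdx d n (extremeIndex d n e) j = n := by
  rcases hj.lt_or_eq with h | rfl
  · simp [absIdx, idx_extremeIndex h]
  · rw [absIdx, idx_extremeIndex_last hd, he]

theorem extremeIndex_mem {d n : ℕ} (hd : 3 ≤ d) {e : ℤ} (he : e.natAbs = n) :
    extremeIndex d n e ∈ indexSet d n := by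
  rw [mem_indexSet]
  refine ⟨fun j hj => ?_, fun j hj => ?_⟩
  · rw [idx_extremeIndex hj]; positivity
  · rw [absIdx_extremeIndex hd he (by omega), idx_extremeIndex hj]

/-- Only the multi-indices `(n, …, n, ±n)` have nonzero directionality. -/
theorem eq_extremeIndex {d n : ℕ} (hd : 3 ≤ d) {k : Fin (d - 2) → ℤ} (hk : k ∈ indexSet d n)
    (h : absIdx d n k (d - 2) = n) : k = extremeIndex d n (idx d n k (d - 2)) := by
  rw [mem_indexSet] at hk
  funext i
  obtain ⟨i, hi⟩ := i
  rw [extremeIndex, ← idx_succ (n := n) k hi]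
  split_ifs with h3
  · congr 1; simp only at h3; omega
  · simp only at h3
    have h1 := absIdx_antitone hk.2 (show i + 1 ≤ d - 2 by omega) le_rfl
    have h2 := absIdx_antitone hk.2 (Nat.zero_le (i + 1)) (by omega)
    have h4 : absIdx d n k 0 = n := by simp [absIdx, idx_zero]
    have h5 := hk.1 (i + 1) (by omega)
    have h6 := coe_absIdx d n k (i + 1)
    rw [abs_of_nonneg h5] at h6
    omega

theorem headNorm_self {d : ℕ} (η : Sph d) : headNorm η.1 d = 1 := by
  have h1 : ‖η.1‖ = 1 := by simp
  rw [EuclideanSpace.norm_eq] at h1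
  refine Eq.trans ?_ h1
  unfold headNorm
  congr 1
  rw [Finset.sum_fin_eq_sum_range]
  refine Finset.sum_bij' (fun i _ => i - 1) (fun i _ => i + 1) ?_ ?_ ?_ ?_ ?_
  · intro a ha; simp at ha ⊢; omega
  · intro a ha; simp at ha ⊢; omega
  · intro a ha; simp at ha ⊢; omega
  · intro a ha; simp at ha ⊢
  · intro a ha; simp at ha; simp [coord]

/-- The first two coordinates of a point, as the complex number `x_2 + i x_1`. -/
noncomputable def firstPlanePart {d : ℕ} (x : EuclideanSpace ℝ (Fin d)) : ℂ :=
  ⟨coord x 2, coord x 1⟩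

theorem prod_sin_angle {d : ℕ} (hd : 3 ≤ d) (η : Sph d) :
    ∏ j ∈ Finset.range (d - 2), Real.sin (angle η.1 (d - j - 1)) = ‖firstPlanePart η.1‖ := by
  have h := headNorm_eq_prod η.1 2 le_rfl (d - 2)
  rw [show 2 + (d - 2) = d by omega, headNorm_self, one_mul] at h
  have h2 : headNorm η.1 2 = ‖firstPlanePart η.1‖ := by
    rw [headNorm, firstPlanePart, Complex.norm_def, Complex.normSq_mk]
    congr 1
    simp [Finset.sum_Icc_succ_top]; ring
  rw [← h2, h]
  refine Finset.prod_bij' (fun j _ => d - j - 1) (fun m _ => d - m - 1) ?_ ?_ ?_ ?_ ?_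
  · intro a ha; simp at ha ⊢; omega
  · intro a ha; simp at ha ⊢; omega
  · intro a ha; simp at ha ⊢; omega
  · intro a ha; simp at ha ⊢; omega
  · intro a ha; rfl

theorem firstPlanePart_eq_exp {d : ℕ} (x : EuclideanSpace ℝ (Fin d)) :
    firstPlanePart x = ‖firstPlanePart x‖ * Complex.exp (Complex.I * angle x 1) := by
  conv_lhs => rw [← Complex.norm_mul_exp_arg_mul_I (firstPlanePart x)]
  rw [mul_comm Complex.I]
  rfl

/-- For the multi-index `(n, …, n, ±n)` all Gegenbauer factors are constant, and the spherical
harmonic is a multiple of `(x_2 ± i x_1) ^ n`. -/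
theorem harmonic_extremeIndex {d n : ℕ} (hd : 3 ≤ d) {e : ℤ} (he : e.natAbs = n) (η : Sph d) :
    harmonic d n (extremeIndex d n e) η =
      normConst d n (extremeIndex d n e) *
        ((‖firstPlanePart η.1‖ : ℂ) ^ n * Complex.exp (Complex.I * e * angle η.1 1)) := by
  rw [harmonic, harmonicOfAngles, idx_extremeIndex_last hd]
  have h : ∏ j ∈ Finset.range (d - 2),
      (gegenbauer (((d : ℝ) - j - 2) / 2 + absIdx d n (extremeIndex d n e) (j + 1))
        (absIdx d n (extremeIndex d n e) j - absIdx d n (extremeIndex d n e) (j + 1))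
          (Real.cos (angle η.1 (d - j - 1))) *
        Real.sin (angle η.1 (d - j - 1)) ^ absIdx d n (extremeIndex d n e) (j + 1)) =
      ‖firstPlanePart η.1‖ ^ n := by
    rw [← prod_sin_angle hd, ← Finset.prod_pow]
    refine Finset.prod_congr rfl fun j hj => ?_
    rw [Finset.mem_range] at hj
    rw [absIdx_extremeIndex hd he (by omega), absIdx_extremeIndex hd he (by omega), Nat.sub_self,
      gegenbauer, one_mul]
  rw [h]
  push_cast
  ring

theorem normConst_extremeIndex {d n : ℕ} (hd : 3 ≤ d) {e : ℤ} (he : e.natAbs = n) :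
    normConst d n (extremeIndex d n e) = normConst d n (extremeIndex d n n) := by
  have h1 : ∀ j ≤ d - 2, absIdx d n (extremeIndex d n e) j = n := fun j hj =>
    absIdx_extremeIndex hd he hj
  have h2 : ∀ j ≤ d - 2, absIdx d n (extremeIndex d n n) j = n := fun j hj =>
    absIdx_extremeIndex hd (Int.natAbs_natCast n) hj
  rw [normConst, normConst]
  congr 2
  refine Finset.prod_congr rfl fun j hj => ?_
  rw [Finset.mem_range] at hj
  rw [h1 j (by omega), h1 (j + 1) (by omega), h2 j (by omega), h2 (j + 1) (by omega)]

/-- The amplitude `√2 √(dim 𝓗_n) A_n` of the degree `n` part of the curvelets, where `A_n` is the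
normalization constant of `Y_{(n, …, n)}`. -/
noncomputable def amplitude (d n : ℕ) : ℝ :=
  √2 * (√(Module.finrank ℂ (harmonicSpace d n) : ℝ) * normConst d n (extremeIndex d n n))

theorem sum_indexSet_eq {d n : ℕ} (hd : 3 ≤ d) (hn : 1 ≤ n) (κ : ℝ) (η : Sph d) :
    ∑ k ∈ indexSet d n, ((√(Module.finrank ℂ (harmonicSpace d n) : ℝ) * κ *
        directionality d n k : ℝ) : ℂ) * harmonic d n k η =
      ((amplitude d n * κ * ((firstPlanePart η.1) ^ n).re : ℝ) : ℂ) := by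
  have hne : extremeIndex d n n ≠ extremeIndex d n (-n) := fun h => by
    have h1 := congrArg (fun k => idx d n k (d - 2)) h
    simp only [idx_extremeIndex_last hd] at h1
    omega
  have hp : (n : ℤ).natAbs = n := Int.natAbs_natCast n
  have hm : (-(n : ℤ)).natAbs = n := by rw [Int.natAbs_neg, hp]
  rw [← Finset.sum_subset (s₁ := {extremeIndex d n n, extremeIndex d n (-n)})]
  · rw [Finset.sum_pair hne, harmonic_extremeIndex hd hp, harmonic_extremeIndex hd hm,
      normConst_extremeIndex hd hm, directionality, directionality,
      if_pos (absIdx_extremeIndex hd hp le_rfl), if_pos (absIdx_extremeIndex hd hm le_rfl)]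
    have hz : (firstPlanePart η.1) ^ n = (‖firstPlanePart η.1‖ : ℂ) ^ n *
        Complex.exp (Complex.I * (n : ℤ) * angle η.1 1) := by
      conv_lhs => rw [firstPlanePart_eq_exp, mul_pow, ← Complex.exp_nat_mul]
      congr 2
      push_cast
      ring
    have hz' : (starRingEnd ℂ) ((firstPlanePart η.1) ^ n) = (‖firstPlanePart η.1‖ : ℂ) ^ n *
        Complex.exp (Complex.I * (-(n : ℤ) : ℤ) * angle η.1 1) := by
      rw [hz, map_mul, map_pow, Complex.conj_ofReal, ← Complex.exp_conj]
      congr 2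
      simp
    rw [← hz, ← hz', amplitude]
    have hre := Complex.add_conj ((firstPlanePart η.1) ^ n)
    have h2 : (√2 : ℝ) * √2 = 2 := Real.mul_self_sqrt (by norm_num)
    have h3 : (1 : ℝ) / √2 = √2 / 2 := by
      rw [div_eq_div_iff (by positivity) (by norm_num)]; linarith
    rw [h3]
    push_cast
    rw [← mul_add, ← mul_add, hre]
    push_cast
    ring
  · intro k hk
    rw [Finset.mem_insert, Finset.mem_singleton] at hk
    rcases hk with rfl | rfl
    · exact extremeIndex_mem hd hp
    · exact extremeIndex_mem hd hm
  · intro k hk hk'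
    rw [directionality, if_neg, mul_zero, Complex.ofReal_zero, zero_mul]
    intro h
    have h1 := eq_extremeIndex hd hk h
    apply hk'
    rw [Finset.mem_insert, Finset.mem_singleton]
    rcases Int.natAbs_eq_iff.1 h with h2 | h2
    · left; rw [h1, h2]
    · right; rw [h1, h2]

theorem curvelet₀_succ {d : ℕ} (hd : 3 ≤ d) {φ : ℝ → ℝ} (h0 : window φ 0 = 0)
    (h2 : ∀ t, 2 ≤ t → window φ t = 0) (j : ℕ) (η : Sph d) :
    curvelet₀ d φ (j + 1) η =
      ((∑ n ∈ Finset.range (2 * 2 ^ j), ((amplitude d n * window φ (n / (2 ^ j : ℕ)) : ℝ) : ℂ) *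
        (firstPlanePart η.1) ^ n).re : ℂ) := by
  rw [curvelet₀, tsum_eq_sum (s := Finset.range (2 * 2 ^ j)), Complex.re_sum, Complex.ofReal_sum]
  · refine Finset.sum_congr rfl fun n _ => ?_
    rw [Complex.re_ofReal_mul]
    rcases Nat.eq_zero_or_pos n with rfl | hn
    · simp [h0]
    · rw [sum_indexSet_eq hd hn]
      push_cast
      rfl
  · intro n hn
    rw [Finset.mem_range, not_lt] at hn
    have : window φ ((n : ℝ) / 2 ^ j) = 0 := h2 _ (by
      rw [le_div_iff₀ (by positivity)]
      exact_mod_cast hn)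
    simp [this]

/-- The rotation `g₀` carries the plane of the first two coordinates to that of the last two. -/
theorem firstPlanePart_rotate_inv {d : ℕ} (hd : 3 ≤ d)
    (g : Matrix.specialOrthogonalGroup (Fin d) ℝ)
    (h1 : rotate g (basisPoint ⟨0, by omega⟩) = basisPoint ⟨d - 2, by omega⟩)
    (h2 : rotate g (basisPoint ⟨1, by omega⟩) = basisPoint ⟨d - 1, by omega⟩) (η : Sph d) :
    firstPlanePart (rotate g⁻¹ η).1 = ⟨η.1 ⟨d - 1, by omega⟩, η.1 ⟨d - 2, by omega⟩⟩ := by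
  have key : ∀ i l : Fin d, rotate g (basisPoint i) = basisPoint l →
      (rotate g⁻¹ η).1 i = η.1 l := by
    intro i l h
    have hcol : ∀ m, (g : Matrix (Fin d) (Fin d) ℝ) m i = if m = l then 1 else 0 := fun m => by
      have := congrArg (fun ξ : Sph d => ξ.1 m) h
      simpa [rotate, basisPoint, Matrix.mulVec_single_one, Pi.single_apply] using this
    have hinv : ((g⁻¹ : Matrix.specialOrthogonalGroup (Fin d) ℝ) : Matrix (Fin d) (Fin d) ℝ) =
        Matrix.transpose (g : Matrix (Fin d) (Fin d) ℝ) := rfl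
    simp [rotate, hinv, Matrix.mulVec, dotProduct, hcol]
  rw [firstPlanePart, coord, coord, dif_pos (by omega), dif_pos (by omega)]
  congr 1
  · exact key _ _ h2
  · exact key _ _ h1

/-! ### Linear independence of the spherical harmonics -/

theorem continuous_gegenbauer (lam : ℝ) (m : ℕ) : Continuous (gegenbauer lam m) := by
  induction m using Nat.twoStepInduction with
  | zero => exact continuous_const
  | one =>
    have : gegenbauer lam 1 = fun t => 2 * lam * t := by funext t; rw [gegenbauer]
    rw [this]; fun_prop
  | more m h1 h2 =>
    have : gegenbauer lam (m + 2) = fun t => (2 * ((m : ℝ) + 1 + lam) * t * gegenbauer lam (m + 1) t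
      - ((m : ℝ) + 2 * lam) * gegenbauer lam m t) / ((m : ℝ) + 2) := by funext t; rw [gegenbauer]
    rw [this]; fun_prop

theorem gegenbauer_one_succ (lam : ℝ) (m : ℕ) :
    ((m : ℝ) + 1) * gegenbauer lam (m + 1) 1 = (m + 2 * lam) * gegenbauer lam m 1 := by
  induction m with
  | zero => simp [gegenbauer]
  | succ m ih =>
    rw [gegenbauer]
    have : (m : ℝ) + 2 ≠ 0 := by positivity
    push_cast
    field_simp
    linear_combination (m + 2 : ℝ) * ih

theorem gegenbauer_one_pos {lam : ℝ} (h : 0 < lam) (m : ℕ) : 0 < gegenbauer lam m 1 := by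
  induction m with
  | zero => simp [gegenbauer]
  | succ m ih =>
    have h1 := gegenbauer_one_succ lam m
    have h2 : 0 < ((m : ℝ) + 1) * gegenbauer lam (m + 1) 1 := by rw [h1]; positivity
    exact pos_of_mul_pos_right h2 (by positivity)

/-- Functions that vanish at `0` to pairwise different orders are linearly independent. -/
theorem eq_zero_of_sum_sin_pow {n : ℕ} {g : ℕ → ℝ → ℝ} (hg : ∀ m, Continuous (g m))
    (h0 : ∀ m, g m 0 ≠ 0) {H : ℕ → ℂ}
    (h : ∀ t ∈ Set.Ioo 0 Real.pi, ∑ m ∈ Finset.range (n + 1),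
      ((g m t * Real.sin t ^ m : ℝ) : ℂ) * H m = 0) : ∀ m ≤ n, H m = 0 := by
  intro m
  induction m using Nat.strong_induction_on with
  | _ m ih =>
  intro hm
  -- the sum divided by `sin t ^ m`
  set G : ℝ → ℂ := fun t => ∑ i ∈ (Finset.range (n + 1)).filter (m ≤ ·),
    ((g i t * Real.sin t ^ (i - m) : ℝ) : ℂ) * H i with hG
  have hGc : Continuous G := by
    refine continuous_finsetSum _ fun i _ => ?_
    have := hg i
    fun_prop
  have hGz : ∀ t ∈ Set.Ioo 0 Real.pi, G t = 0 := by
    intro t ht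
    have hs : 0 < Real.sin t := Real.sin_pos_of_mem_Ioo ht
    have h1 : ((Real.sin t ^ m : ℝ) : ℂ) * G t = 0 := by
      rw [← h t ht, hG, Finset.mul_sum]
      rw [← Finset.sum_filter_add_sum_filter_not (Finset.range (n + 1)) (m ≤ ·)
        (fun i => ((g i t * Real.sin t ^ i : ℝ) : ℂ) * H i)]
      rw [Finset.sum_eq_zero (s := (Finset.range (n + 1)).filter (¬ m ≤ ·)), add_zero]
      · refine Finset.sum_congr rfl fun i hi => ?_
        have hmi : m ≤ i := (Finset.mem_filter.1 hi).2
        rw [← mul_assoc, ← Complex.ofReal_mul]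
        congr 2
        rw [← Nat.add_sub_cancel' hmi, Nat.add_sub_cancel_left, pow_add]
        ring
      · intro i hi
        rw [Finset.mem_filter, Finset.mem_range] at hi
        rw [ih i (by omega) (by omega), mul_zero]
    exact (mul_eq_zero.1 h1).resolve_left (by exact_mod_cast (pow_pos hs m).ne')
  have hG0 : G 0 = 0 := by
    have h1 : Set.EqOn G 0 (closure (Set.Ioo 0 Real.pi)) :=
      Set.EqOn.closure (fun t ht => hGz t ht) hGc continuous_zero
    rw [closure_Ioo Real.pi_pos.ne] at h1
    exact h1 ⟨le_rfl, Real.pi_pos.le⟩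
  rw [hG] at hG0
  simp only at hG0
  rw [Finset.sum_eq_single m] at hG0
  · rw [Nat.sub_self, pow_zero, mul_one] at hG0
    exact (mul_eq_zero.1 hG0).resolve_left (by exact_mod_cast h0 m)
  · intro i hi hne
    rw [Finset.mem_filter] at hi
    rw [Real.sin_zero, zero_pow (by omega), mul_zero, Complex.ofReal_zero, zero_mul]
  · intro hm'
    exact absurd (Finset.mem_filter.2 ⟨Finset.mem_range.2 (by omega), le_rfl⟩) hm'

/-- The spherical harmonics without their normalization constants, in spherical coordinates. -/
noncomputable def rawHarmonic (d n : ℕ) (k : Fin (d - 2) → ℤ) (θ : ℕ → ℝ) : ℂ :=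
  ((∏ j ∈ Finset.range (d - 2),
      (gegenbauer (((d : ℝ) - j - 2) / 2 + absIdx d n k (j + 1))
          (absIdx d n k j - absIdx d n k (j + 1)) (Real.cos (θ (d - j - 1))) *
        Real.sin (θ (d - j - 1)) ^ absIdx d n k (j + 1)) : ℝ) : ℂ) *
    Complex.exp (Complex.I * (idx d n k (d - 2) : ℂ) * (θ 1 : ℂ))

theorem harmonicOfAngles_eq (d n : ℕ) (k : Fin (d - 2) → ℤ) (θ : ℕ → ℝ) :
    harmonicOfAngles d n k θ = normConst d n k * rawHarmonic d n k θ := by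
  rw [harmonicOfAngles, rawHarmonic]
  push_cast
  ring

/-- The function of the last angle `θ_{d-1}` in `Y_k^{d,n}` is this function times
`sin θ_{d-1} ^ m`, where `m = |k_1|`. -/
noncomputable def topFactor (d n m : ℕ) (t : ℝ) : ℝ :=
  gegenbauer (((d : ℝ) - 2) / 2 + m) (n - m) (Real.cos t)

theorem continuous_topFactor (d n m : ℕ) : Continuous (topFactor d n m) :=
  (continuous_gegenbauer _ _).comp Real.continuous_cos

theorem topFactor_zero_ne {d : ℕ} (hd : 3 ≤ d) (n m : ℕ) : topFactor d n m 0 ≠ 0 := by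
  rw [topFactor, Real.cos_zero]
  have : (3 : ℝ) ≤ d := by exact_mod_cast hd
  exact (gegenbauer_one_pos (by
    have : (0 : ℝ) ≤ m := by positivity
    linarith) _).ne'

theorem idx_cons {D n m : ℕ} (k : Fin D → ℤ) (j : ℕ) :
    idx (D + 3) n (Fin.cons (m : ℤ) k : Fin (D + 1) → ℤ) (j + 1) = idx (D + 2) m k j := by
  cases j with
  | zero => rfl
  | succ j =>
    rw [idx, idx]
    by_cases h : j < D
    · rw [dif_pos (show j + 1 < D + 3 - 2 by omega), dif_pos (show j < D + 2 - 2 by omega)]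
      exact Fin.cons_succ (α := fun _ => ℤ) (m : ℤ) k ⟨j, h⟩
    · rw [dif_neg (show ¬ j + 1 < D + 3 - 2 by omega), dif_neg (show ¬ j < D + 2 - 2 by omega)]

theorem absIdx_cons {D n m : ℕ} (k : Fin D → ℤ) (j : ℕ) :
    absIdx (D + 3) n (Fin.cons (m : ℤ) k : Fin (D + 1) → ℤ) (j + 1) = absIdx (D + 2) m k j := by
  rw [absIdx, idx_cons, absIdx]

theorem cons_mem_indexSet {D n m : ℕ} (hD : 1 ≤ D) (k : Fin D → ℤ) :
    (Fin.cons (m : ℤ) k : Fin (D + 1) → ℤ) ∈ indexSet (D + 3) n ↔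
      m ≤ n ∧ k ∈ indexSet (D + 2) m := by
  rw [mem_indexSet, mem_indexSet]
  constructor
  · rintro ⟨h1, h2⟩
    refine ⟨?_, fun j hj => ?_, fun j hj => ?_⟩
    · have := h2 0 (by omega)
      rw [absIdx_cons, idx_zero] at this
      simpa [absIdx, idx_zero] using this
    · have := h1 (j + 1) (by omega)
      rwa [idx_cons] at this
    · have := h2 (j + 1) (by omega)
      rwa [absIdx_cons, idx_cons] at this
  · rintro ⟨h0, h1, h2⟩
    refine ⟨fun j hj => ?_, fun j hj => ?_⟩
    · cases j with
      | zero => rw [idx_zero]; positivity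
      | succ j => rw [idx_cons]; exact h1 j (by omega)
    · cases j with
      | zero => rw [absIdx_cons, idx_zero]; simpa [absIdx, idx_zero] using h0
      | succ j => rw [absIdx_cons, idx_cons]; exact h2 j (by omega)

theorem exists_eq_cons {D n : ℕ} (hD : 1 ≤ D) {k : Fin (D + 1) → ℤ}
    (hk : k ∈ indexSet (D + 3) n) :
    ∃ (m : ℕ) (k' : Fin D → ℤ), m ≤ n ∧ k' ∈ indexSet (D + 2) m ∧ k = Fin.cons (m : ℤ) k' := by
  have h1 : 0 ≤ k 0 := by
    have := (mem_indexSet.1 hk).1 1 (by omega)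
    rw [idx_succ _ (by omega)] at this
    exact this
  have h2 : k = Fin.cons (((k 0).toNat : ℕ) : ℤ) (Fin.tail k) := by
    rw [Int.toNat_of_nonneg h1, Fin.cons_self_tail]
  refine ⟨(k 0).toNat, Fin.tail k, ?_, ?_, h2⟩
  · exact ((cons_mem_indexSet hD _).1 (h2 ▸ hk)).1
  · exact ((cons_mem_indexSet hD _).1 (h2 ▸ hk)).2

/-- A sum over the multi-indices in dimension `d + 1`, sorted by `k_1 = m`. -/
theorem sum_indexSet_cons {M : Type*} [AddCommMonoid M] {D n : ℕ} (hD : 1 ≤ D)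
    (F : (Fin (D + 1) → ℤ) → M) :
    ∑ k ∈ indexSet (D + 3) n, F k =
      ∑ m ∈ Finset.range (n + 1), ∑ k ∈ indexSet (D + 2) m, F (Fin.cons (m : ℤ) k) := by
  rw [Finset.sum_sigma']
  symm
  refine Finset.sum_bij (fun (x : Σ _ : ℕ, Fin D → ℤ) _ =>
    (Fin.cons (x.1 : ℤ) x.2 : Fin (D + 1) → ℤ)) ?_ ?_ ?_ ?_
  · rintro ⟨m, k⟩ h
    rw [Finset.mem_sigma, Finset.mem_range] at h
    exact (cons_mem_indexSet hD k).2 ⟨by have := h.1; simp only at this; omega, h.2⟩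
  · rintro ⟨m, k⟩ _ ⟨m', k'⟩ _ h
    obtain ⟨h1, h2⟩ := Fin.cons_inj.1 h
    simp only at h1 h2
    have h3 : m = m' := by exact_mod_cast h1
    subst h3 h2
    rfl
  · intro k hk
    obtain ⟨m, k', hm, hk', rfl⟩ := exists_eq_cons hD hk
    exact ⟨⟨m, k'⟩, Finset.mem_sigma.2 ⟨Finset.mem_range.2 (by simp only; omega), hk'⟩, rfl⟩
  · intro _ _; rfl

theorem rawHarmonic_cons {D n m : ℕ} (k : Fin D → ℤ) (θ : ℕ → ℝ) :
    rawHarmonic (D + 3) n (Fin.cons (m : ℤ) k : Fin (D + 1) → ℤ) θ =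
      ((topFactor (D + 3) n m (θ (D + 2)) * Real.sin (θ (D + 2)) ^ m : ℝ) : ℂ) *
        rawHarmonic (D + 2) m k θ := by
  have h0 : absIdx (D + 3) n (Fin.cons (m : ℤ) k : Fin (D + 1) → ℤ) 0 = n := rfl
  have h1 : absIdx (D + 2) m k 0 = m := rfl
  rw [rawHarmonic, rawHarmonic, show D + 3 - 2 = D + 1 by omega, Finset.prod_range_succ',
    idx_cons, show D + 2 - 2 = D by omega]
  simp only [absIdx_cons, h0]
  rw [h1, topFactor]
  have h2 : ∀ j ∈ Finset.range D,
      gegenbauer ((((D + 3 : ℕ) : ℝ) - (j + 1 : ℕ) - 2) / 2 + absIdx (D + 2) m k (j + 1))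
          (absIdx (D + 2) m k j - absIdx (D + 2) m k (j + 1))
          (Real.cos (θ (D + 3 - (j + 1) - 1))) *
        Real.sin (θ (D + 3 - (j + 1) - 1)) ^ absIdx (D + 2) m k (j + 1) =
      gegenbauer ((((D + 2 : ℕ) : ℝ) - j - 2) / 2 + absIdx (D + 2) m k (j + 1))
          (absIdx (D + 2) m k j - absIdx (D + 2) m k (j + 1)) (Real.cos (θ (D + 2 - j - 1))) *
        Real.sin (θ (D + 2 - j - 1)) ^ absIdx (D + 2) m k (j + 1) := fun j _ => by
    rw [show D + 3 - (j + 1) - 1 = D + 2 - j - 1 by omega]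
    congr 4
    push_cast
    ring
  rw [Finset.prod_congr rfl h2]
  simp only [Nat.cast_zero, sub_zero, show D + 3 - 0 - 1 = D + 2 by omega]
  push_cast
  ring

theorem rawHarmonic_congr {D n : ℕ} (k : Fin D → ℤ) {θ θ' : ℕ → ℝ}
    (h : ∀ m, 1 ≤ m → m ≤ D + 1 → θ m = θ' m) :
    rawHarmonic (D + 2) n k θ = rawHarmonic (D + 2) n k θ' := by
  rw [rawHarmonic, rawHarmonic, h 1 le_rfl (by omega)]
  congr 2
  refine Finset.prod_congr rfl fun j hj => ?_
  rw [Finset.mem_range] at hj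
  rw [h (D + 2 - j - 1) (by omega) (by omega)]

/-- The open set of spherical coordinates `θ_1 ∈ (-π, π)`, `θ_m ∈ (0, π)` for `2 ≤ m < d`. -/
def angleDomain (d : ℕ) : Set (ℕ → ℝ) :=
  {θ | θ 1 ∈ Set.Ioo (-Real.pi) Real.pi ∧ ∀ m, 2 ≤ m → m < d → θ m ∈ Set.Ioo 0 Real.pi}

theorem sum_indexSet_three {M : Type*} [AddCommMonoid M] (n : ℕ) (F : (Fin 1 → ℤ) → M) :
    ∑ k ∈ indexSet 3 n, F k =
      ∑ m ∈ Finset.range (n + 1),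
        ∑ e ∈ (Finset.Icc (-(m : ℤ)) m).filter (fun e => e.natAbs = m), F (fun _ => e) := by
  rw [Finset.sum_sigma']
  refine Finset.sum_bij' (fun (k : Fin 1 → ℤ) _ => (⟨(k 0).natAbs, k 0⟩ : Σ _ : ℕ, ℤ))
    (fun x _ => fun _ => x.2) ?_ ?_ ?_ ?_ ?_
  · intro k hk
    have h := (mem_indexSet.1 hk).2 0 (by omega)
    rw [idx_zero, absIdx, idx_succ _ (by omega)] at h
    have h' : (k 0).natAbs ≤ n := by exact_mod_cast h
    simp only [Finset.mem_sigma, Finset.mem_range, Finset.mem_filter, Finset.mem_Icc, and_true]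
    omega
  · rintro ⟨m, e⟩ h
    simp only [Finset.mem_sigma, Finset.mem_range, Finset.mem_filter, Finset.mem_Icc] at h
    rw [mem_indexSet]
    refine ⟨fun j hj => ?_, fun j hj => ?_⟩
    · obtain rfl : j = 0 := by omega
      rw [idx_zero]; positivity
    · obtain rfl : j = 0 := by omega
      rw [idx_zero, absIdx, idx_succ _ (by omega)]
      simp only
      omega
  · intro k _
    funext i
    exact congrArg k (Subsingleton.elim (α := Fin 1) _ _)
  · rintro ⟨m, e⟩ h
    simp only [Finset.mem_sigma, Finset.mem_range, Finset.mem_filter, Finset.mem_Icc] at h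
    obtain ⟨_, _, rfl⟩ := h
    rfl
  · intro k _
    congr 1
    funext i
    exact congrArg k (Subsingleton.elim (α := Fin 1) _ _)

theorem eq_zero_of_trigonometric {m : ℕ} {c : ℤ → ℂ}
    (h : ∀ t ∈ Set.Ioo (-Real.pi) Real.pi,
      ∑ e ∈ (Finset.Icc (-(m : ℤ)) m).filter (fun e => e.natAbs = m),
        c e * Complex.exp (Complex.I * e * t) = 0) : ∀ e : ℤ, e.natAbs = m → c e = 0 := by
  rcases Nat.eq_zero_or_pos m with rfl | hm
  · intro e he
    obtain rfl : e = 0 := Int.natAbs_eq_zero.1 he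
    have := h 0 ⟨by linarith [Real.pi_pos], Real.pi_pos⟩
    simpa [Finset.sum_filter] using this
  · have hs : (Finset.Icc (-(m : ℤ)) m).filter (fun e => e.natAbs = m) = {(m : ℤ), -(m : ℤ)} := by
      ext e
      simp only [Finset.mem_filter, Finset.mem_Icc, Finset.mem_insert, Finset.mem_singleton]
      omega
    have hne : (m : ℤ) ≠ -(m : ℤ) := by omega
    simp only [hs, Finset.sum_pair hne] at h
    have h1 := h 0 ⟨by linarith [Real.pi_pos], Real.pi_pos⟩
    have hm0 : (1 : ℝ) ≤ m := by exact_mod_cast hm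
    have hmc : (m : ℂ) ≠ 0 := by exact_mod_cast hm.ne'
    -- at this angle the two exponentials are `i` and `-i`
    have h2 := h (Real.pi / (2 * m)) ⟨by
      have : 0 < Real.pi / (2 * m) := by positivity
      linarith [Real.pi_pos], by
      rw [div_lt_iff₀ (by positivity)]; nlinarith [Real.pi_pos]⟩
    have e1 : Complex.exp (Complex.I * ((m : ℤ) : ℂ) * ((Real.pi / (2 * m) : ℝ) : ℂ)) =
        Complex.I := by
      rw [show Complex.I * ((m : ℤ) : ℂ) * ((Real.pi / (2 * m) : ℝ) : ℂ) =
        Real.pi / 2 * Complex.I by push_cast; field_simp]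
      exact Complex.exp_pi_div_two_mul_I
    have e2 : Complex.exp (Complex.I * ((-(m : ℤ) : ℤ) : ℂ) * ((Real.pi / (2 * m) : ℝ) : ℂ)) =
        -Complex.I := by
      rw [show Complex.I * ((-(m : ℤ) : ℤ) : ℂ) * ((Real.pi / (2 * m) : ℝ) : ℂ) =
        -(Real.pi / 2 * Complex.I) by push_cast; field_simp, Complex.exp_neg,
        Complex.exp_pi_div_two_mul_I, Complex.inv_I]
    rw [e1, e2] at h2
    simp only [Complex.ofReal_zero, mul_zero, Complex.exp_zero, mul_one] at h1
    have h3 : c m = c (-m) := by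
      have : Complex.I * (c m - c (-m)) = 0 := by linear_combination h2
      exact sub_eq_zero.1 ((mul_eq_zero.1 this).resolve_left Complex.I_ne_zero)
    have h4 : c (-m) = 0 := by
      have : (2 : ℂ) * c (-m) = 0 := by linear_combination h1 - h3
      exact (mul_eq_zero.1 this).resolve_left two_ne_zero
    intro e he
    rcases Int.natAbs_eq_iff.1 he with rfl | rfl
    · rw [h3, h4]
    · exact h4

/-- Linear independence in spherical coordinates: the order of vanishing at `θ_{d-1} = 0` separates
the different values of `k_1`, and the claim follows by induction on the dimension. -/
theorem rawHarmonic_independent (D : ℕ) (hD : 1 ≤ D) (n : ℕ) (c : (Fin D → ℤ) → ℂ)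
    (h : ∀ θ ∈ angleDomain (D + 2),
      ∑ k ∈ indexSet (D + 2) n, c k * rawHarmonic (D + 2) n k θ = 0) :
    ∀ k ∈ indexSet (D + 2) n, c k = 0 := by
  induction D, hD using Nat.le_induction generalizing n with
  | base =>
    have key : ∀ m ≤ n, ∀ t ∈ Set.Ioo (-Real.pi) Real.pi,
        ∑ e ∈ (Finset.Icc (-(m : ℤ)) m).filter (fun e => e.natAbs = m),
          c (fun _ => e) * Complex.exp (Complex.I * e * t) = 0 := by
      intro m hm t ht
      refine eq_zero_of_sum_sin_pow (n := n) (continuous_topFactor 3 n)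
        (topFactor_zero_ne le_rfl n) (H := fun m =>
          ∑ e ∈ (Finset.Icc (-(m : ℤ)) m).filter (fun e => e.natAbs = m),
          c (fun _ => e) * Complex.exp (Complex.I * e * t)) (fun s hs => ?_) m hm
      have h1 := h (fun i => if i = 1 then t else s)
        ⟨by simpa using ht, fun i hi _ => by
          simp only [show i ≠ 1 by omega, if_false]; exact hs⟩
      rw [sum_indexSet_three] at h1
      rw [← h1]
      refine Finset.sum_congr rfl fun i _ => ?_
      rw [Finset.mul_sum]
      refine Finset.sum_congr rfl fun e he => ?_
      have he' : e.natAbs = i := (Finset.mem_filter.1 he).2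
      have a0 : absIdx (1 + 2) n (fun _ => e) 0 = n := rfl
      have a1 : absIdx (1 + 2) n (fun _ => e) (0 + 1) = i := he'
      have a2 : idx (1 + 2) n (fun _ => e) 1 = e := rfl
      rw [rawHarmonic, show 1 + 2 - 2 = 1 by omega, Finset.prod_range_one, a0, a1, a2, topFactor]
      simp
      ring
    intro k hk
    have h2 := (mem_indexSet.1 hk).2 0 (by omega)
    rw [idx_zero, absIdx, idx_succ _ (by omega)] at h2
    have h3 : (k 0).natAbs ≤ n := by exact_mod_cast h2
    have h4 := eq_zero_of_trigonometric (m := (k 0).natAbs) (c := fun e => c (fun _ => e))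
      (key _ h3) (k 0) rfl
    have h5 : k = fun _ => k 0 := by
      funext i; exact congrArg k (Subsingleton.elim (α := Fin 1) _ _)
    rw [h5]
    exact h4
  | succ D hD ih =>
    intro k hk
    obtain ⟨m, k', hm, hk', rfl⟩ := exists_eq_cons hD hk
    refine ih m (fun k' => c (Fin.cons (m : ℤ) k')) (fun θ hθ => ?_) k' hk'
    refine eq_zero_of_sum_sin_pow (n := n) (continuous_topFactor (D + 3) n)
      (topFactor_zero_ne (by omega) n) (H := fun m => ∑ k ∈ indexSet (D + 2) m,
        c (Fin.cons (m : ℤ) k) * rawHarmonic (D + 2) m k θ) (fun s hs => ?_) m hm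
    have h1 := h (Function.update θ (D + 2) s) ⟨by
        rw [Function.update_of_ne (by omega)]; exact hθ.1, fun i hi hi' => by
        rcases eq_or_ne i (D + 2) with rfl | hne
        · rw [Function.update_self]; exact hs
        · rw [Function.update_of_ne hne]; exact hθ.2 i hi (by omega)⟩
    refine Eq.trans ?_ ((sum_indexSet_cons hD _).symm.trans h1)
    refine Finset.sum_congr rfl fun i _ => ?_
    rw [Finset.mul_sum]
    refine Finset.sum_congr rfl fun k _ => ?_
    rw [rawHarmonic_cons, Function.update_self, rawHarmonic_congr (D := D)
      (θ := Function.update θ (D + 2) s) (θ' := θ) k fun i _ hi => Function.update_of_ne (by omega) _ _]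
    ring

theorem sum_sq_sphericalPoint (d : ℕ) (θ : ℕ → ℝ) {M : ℕ} (hM : 2 ≤ M) :
    M ≤ d → ∑ i ∈ Finset.Icc 1 M, sphericalPoint d θ i ^ 2 =
      (∏ m ∈ Finset.Icc M (d - 1), Real.sin (θ m)) ^ 2 := by
  induction M, hM using Nat.le_induction with
  | base =>
    intro _
    rw [Finset.sum_Icc_succ_top (by omega), Finset.Icc_self, Finset.sum_singleton, sphericalPoint,
      if_pos rfl, sphericalPoint, if_neg (by omega)]
    have := Real.sin_sq_add_cos_sq (θ 1)
    simp only [show 1 + 1 = 2 by rfl, show 2 - 1 = 1 by rfl]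
    linear_combination (∏ m ∈ Finset.Icc 2 (d - 1), Real.sin (θ m)) ^ 2 * this
  | succ M hM ih =>
    intro hMd
    rw [Finset.sum_Icc_succ_top (by omega), ih (by omega), sphericalPoint, if_neg (by omega),
      ← Finset.mul_prod_Ioc_eq_prod_Icc (show M ≤ d - 1 by omega),
      show Finset.Ioc M (d - 1) = Finset.Icc (M + 1) (d - 1) by
        ext; simp only [Finset.mem_Ioc, Finset.mem_Icc]; omega,
      Nat.add_sub_cancel]
    have := Real.sin_sq_add_cos_sq (θ M)
    linear_combination (∏ m ∈ Finset.Icc (M + 1) (d - 1), Real.sin (θ m)) ^ 2 * this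

/-- All spherical coordinates in the open domain occur. -/
theorem exists_angle_eq {d : ℕ} (hd : 3 ≤ d) {θ : ℕ → ℝ} (hθ : θ ∈ angleDomain d) :
    ∃ η : Sph d, ∀ m, 1 ≤ m → m < d → angle η.1 m = θ m := by
  set x : EuclideanSpace ℝ (Fin d) := WithLp.toLp 2 fun i => sphericalPoint d θ (i + 1) with hx
  have hcoord : ∀ i, 1 ≤ i → i ≤ d → coord x i = sphericalPoint d θ i := fun i h1 h2 => by
    rw [coord, dif_pos (by omega), hx]
    simp only
    rw [Nat.sub_add_cancel h1]
  have hprod : ∀ M, 2 ≤ M → 0 < ∏ m ∈ Finset.Icc M (d - 1), Real.sin (θ m) := fun M hM =>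
    Finset.prod_pos fun m hm => by
      rw [Finset.mem_Icc] at hm
      exact Real.sin_pos_of_mem_Ioo (hθ.2 m (by omega) (by omega))
  have hhead : ∀ M, 2 ≤ M → M ≤ d →
      headNorm x M = ∏ m ∈ Finset.Icc M (d - 1), Real.sin (θ m) := fun M h1 h2 => by
    have h3 : ∑ i ∈ Finset.Icc 1 M, coord x i ^ 2 =
        ∑ i ∈ Finset.Icc 1 M, sphericalPoint d θ i ^ 2 :=
      Finset.sum_congr rfl fun i hi => by
        rw [Finset.mem_Icc] at hi
        rw [hcoord i hi.1 (by omega)]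
    rw [headNorm, h3, sum_sq_sphericalPoint d θ h1 h2, Real.sqrt_sq (hprod M h1).le]
  have hnorm : ‖x‖ = 1 := by
    have h1 := sum_sq_sphericalPoint d θ (M := d) (by omega) le_rfl
    rw [Finset.Icc_eq_empty (a := d) (by omega), Finset.prod_empty, one_pow] at h1
    have h2 : ‖x‖ ^ 2 = 1 := by
      rw [EuclideanSpace.real_norm_sq_eq, ← h1]
      rw [Fin.sum_univ_eq_sum_range (fun i => sphericalPoint d θ (i + 1) ^ 2) d,
        Finset.range_eq_Ico, Finset.sum_Ico_add' (fun i => sphericalPoint d θ i ^ 2) 0 d 1]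
      rfl
    nlinarith [norm_nonneg x]
  refine ⟨⟨x, by simpa using hnorm⟩, fun m h1 h2 => ?_⟩
  rcases eq_or_ne m 1 with rfl | hm
  · rw [angle, if_pos rfl, hcoord 2 (by omega) (by omega), hcoord 1 le_rfl (by omega),
      sphericalPoint, sphericalPoint, if_neg (by omega), if_pos rfl]
    have h3 : (⟨(∏ m ∈ Finset.Icc 2 (d - 1), Real.sin (θ m)) * Real.cos (θ (2 - 1)),
        (∏ m ∈ Finset.Icc 2 (d - 1), Real.sin (θ m)) * Real.sin (θ 1)⟩ : ℂ) =
        ((∏ m ∈ Finset.Icc 2 (d - 1), Real.sin (θ m) : ℝ) : ℂ) *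
          (Complex.cos (θ 1) + Complex.sin (θ 1) * Complex.I) := by
      rw [← Complex.ofReal_cos, ← Complex.ofReal_sin]
      apply Complex.ext
      · rw [Complex.re_ofReal_mul]; simp [-Complex.ofReal_cos, -Complex.ofReal_sin]
      · rw [Complex.im_ofReal_mul]; simp [-Complex.ofReal_cos, -Complex.ofReal_sin]
    rw [h3]
    exact Complex.arg_mul_cos_add_sin_mul_I (hprod 2 le_rfl) ⟨hθ.1.1, hθ.1.2.le⟩
  · rw [angle, if_neg hm, hcoord (m + 1) (by omega) (by omega), hhead (m + 1) (by omega) (by omega),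
      sphericalPoint, if_neg (by omega), Nat.add_sub_cancel,
      mul_div_cancel_left₀ _ (hprod (m + 1) (by omega)).ne']
    have := hθ.2 m (by omega) h2
    exact Real.arccos_cos this.1.le this.2.le

theorem normConst_pos (d n : ℕ) (hd : 3 ≤ d) (k : Fin (d - 2) → ℤ) : 0 < normConst d n k := by
  rw [normConst]
  apply Real.sqrt_pos.2
  have hd' : (3 : ℝ) ≤ d := by exact_mod_cast hd
  refine mul_pos (div_pos (by positivity) (Real.Gamma_pos_of_pos (by linarith)))
    (Finset.prod_pos fun j hj => ?_)
  rw [Finset.mem_range] at hj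
  have hj' : (j : ℝ) + 3 ≤ d := by exact_mod_cast (show j + 3 ≤ d by omega)
  have h0 : (0 : ℝ) ≤ absIdx d n k j := by positivity
  have h1 : (0 : ℝ) ≤ absIdx d n k (j + 1) := by positivity
  have h2 : 0 < Real.Gamma (((d : ℝ) - j - 2) / 2 + absIdx d n k (j + 1)) :=
    Real.Gamma_pos_of_pos (by linarith)
  have h3 : 0 < Real.Gamma ((absIdx d n k j : ℝ) + absIdx d n k (j + 1) + d - j - 2) :=
    Real.Gamma_pos_of_pos (by linarith)
  have h4 : 0 < 2 * (absIdx d n k j : ℝ) + d - j - 2 := by linarith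
  positivity

theorem linearIndepOn_harmonic {D : ℕ} (hD : 1 ≤ D) (n : ℕ) :
    LinearIndepOn ℂ (fun k => harmonic (D + 2) n k)
      (indexSet (D + 2) n : Set (Fin (D + 2 - 2) → ℤ)) := by
  rw [linearIndepOn_finset_iff]
  intro f hf k hk
  have h := rawHarmonic_independent D hD n (fun k => f k * normConst (D + 2) n k) (fun θ hθ => ?_)
    k hk
  · exact (mul_eq_zero.1 h).resolve_right
      (by exact_mod_cast (normConst_pos (D + 2) n (by omega) k).ne')
  · obtain ⟨η, hη⟩ := exists_angle_eq (by omega) hθ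
    have h1 := congrFun hf η
    rw [Finset.sum_apply] at h1
    refine Eq.trans (Finset.sum_congr rfl fun k _ => ?_) h1
    rw [Pi.smul_apply, smul_eq_mul, harmonic, harmonicOfAngles_eq, mul_assoc]
    congr 2
    exact rawHarmonic_congr (D := D) k fun m h1 h2 => (hη m h1 (by omega)).symm

theorem finrank_harmonicSpace {D : ℕ} (hD : 1 ≤ D) (n : ℕ) :
    Module.finrank ℂ (harmonicSpace (D + 2) n) = (indexSet (D + 2) n).card := by
  rw [harmonicSpace, Set.image_eq_range]
  have := finrank_span_eq_card (linearIndepOn_harmonic hD n)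
  rw [this]
  exact Fintype.card_coe _

/-! ### The amplitudes are symbols -/

theorem card_indexSet_three (n : ℕ) : (indexSet 3 n).card = 2 * n + 1 := by
  have h : (Finset.Icc (-(n : ℤ)) n).card = 2 * n + 1 := by
    rw [Int.card_Icc]; omega
  rw [← h]
  refine Finset.card_bij' (fun (k : Fin 1 → ℤ) _ => k 0) (fun e _ => fun _ => e) ?_ ?_ ?_ ?_
  · intro k hk
    have h := (mem_indexSet.1 hk).2 0 (by omega)
    rw [idx_zero, coe_absIdx, idx_succ _ (by omega)] at h
    exact Finset.mem_Icc.2 (abs_le.1 h)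
  · intro e he
    rw [mem_indexSet]
    refine ⟨fun j hj => ?_, fun j hj => ?_⟩
    · obtain rfl : j = 0 := by omega
      rw [idx_zero]; positivity
    · obtain rfl : j = 0 := by omega
      rw [idx_zero, coe_absIdx, idx_succ _ (by omega)]
      exact abs_le.2 (Finset.mem_Icc.1 he)
  · intro k _
    funext i
    exact congrArg k (Subsingleton.elim (α := Fin 1) _ _)
  · intro e _; rfl

theorem pow_succ_le_sum (D n : ℕ) :
    ((n : ℝ) + 1) ^ (D + 1) ≤ (D + 1) * ∑ m ∈ Finset.range (n + 1), ((m : ℝ) + 1) ^ D := by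
  induction n with
  | zero => simp
  | succ n ih =>
    rw [Finset.sum_range_succ, mul_add]
    set x : ℝ := (n : ℝ) + 2 with hx
    have hx1 : 1 < x := by rw [hx]; have : (0 : ℝ) ≤ n := by positivity
                           linarith
    have hx0 : 0 < x := by linarith
    have hB := one_add_mul_le_pow (a := -(1 / x)) (by
      have : 1 / x < 1 := by rw [div_lt_one hx0]; exact hx1
      linarith) (D + 1)
    have h1 : (x - 1) ^ (D + 1) = x ^ (D + 1) * (1 + -(1 / x)) ^ (D + 1) := by
      rw [← mul_pow]; congr 1; field_simp; ring
    have h2 : x ^ (D + 1) * (1 + ((D + 1 : ℕ) : ℝ) * -(1 / x)) = x ^ (D + 1) - (D + 1) * x ^ D := by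
      push_cast; field_simp; ring
    have h3 : x ^ (D + 1) - (D + 1) * x ^ D ≤ (x - 1) ^ (D + 1) := by
      rw [h1, ← h2]
      exact mul_le_mul_of_nonneg_left hB (by positivity)
    have e1 : ((n + 1 : ℕ) : ℝ) + 1 = x := by push_cast; ring
    have e2 : (n : ℝ) + 1 = x - 1 := by rw [hx]; ring
    rw [e1]
    rw [e2] at ih
    linarith

/-- The dimension of `𝓗_n` is a symbol of order `d - 2`: its difference in `n` is the dimension in
one dimension less. -/
theorem card_indexSet_symbol (D : ℕ) (hD : 1 ≤ D) :
    (∃ c : ℝ, 0 < c ∧ ∀ n : ℕ, c * ((n : ℝ) + 1) ^ (D : ℝ) ≤ (indexSet (D + 2) n).card) ∧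
      ∀ m, IsSymbol m D (fun (_ : Unit) n => ((indexSet (D + 2) n).card : ℝ)) := by
  induction D, hD using Nat.le_induction with
  | base =>
    have h : ∀ n, ((indexSet (1 + 2) n).card : ℝ) = 2 * n + 1 := fun n => by
      have := card_indexSet_three n
      rw [show (indexSet (1 + 2) n).card = 2 * n + 1 from this]; push_cast; rfl
    refine ⟨⟨1, one_pos, fun n => ?_⟩, fun m => ?_⟩
    · rw [h, Nat.cast_one, Real.rpow_one]
      have : (0 : ℝ) ≤ n := by positivity
      linarith
    · simp only [h, Nat.cast_one]
      exact IsSymbol.affine 2 1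
  | succ D hD ih =>
    obtain ⟨⟨c, hc, hlow⟩, hsym⟩ := ih
    have hrec : ∀ n, ((indexSet (D + 1 + 2) n).card : ℝ) =
        ∑ m ∈ Finset.range (n + 1), ((indexSet (D + 2) m).card : ℝ) := fun n => by
      have := sum_indexSet_cons (n := n) hD (fun _ => (1 : ℝ))
      simp only [Finset.sum_const, nsmul_eq_mul, mul_one] at this
      exact this
    have key : ∃ C : ℝ, ∀ (_ : Unit) (n : ℕ), |((indexSet (D + 1 + 2) n).card : ℝ)| ≤
        C * ((n : ℝ) + 1) ^ ((D + 1 : ℕ) : ℝ) := by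
      obtain ⟨C, hC0, hC⟩ := (hsym 0).bound_pos
      refine ⟨C, fun _ n => ?_⟩
      rw [Nat.abs_cast, hrec]
      calc ∑ m ∈ Finset.range (n + 1), ((indexSet (D + 2) m).card : ℝ)
          ≤ ∑ m ∈ Finset.range (n + 1), C * ((n : ℝ) + 1) ^ (D : ℝ) := by
            refine Finset.sum_le_sum fun m hm => ?_
            rw [Finset.mem_range] at hm
            refine ((le_abs_self _).trans (hC () m)).trans ?_
            have : (m : ℝ) ≤ n := by exact_mod_cast Nat.lt_succ_iff.1 hm
            gcongr
        _ = _ := by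
          rw [Finset.sum_const, Finset.card_range, nsmul_eq_mul, Nat.cast_add, Nat.cast_one (R := ℝ),
            Nat.cast_add, Nat.cast_one, Real.rpow_add_one (by positivity)]
          ring
    refine ⟨⟨c / (D + 1), by positivity, fun n => ?_⟩, fun m => ?_⟩
    · rw [hrec, Real.rpow_natCast, div_mul_eq_mul_div, div_le_iff₀ (by positivity)]
      calc c * ((n : ℝ) + 1) ^ (D + 1)
          ≤ c * ((D + 1) * ∑ m ∈ Finset.range (n + 1), ((m : ℝ) + 1) ^ D) := by
            gcongr; exact pow_succ_le_sum D n
        _ = (∑ m ∈ Finset.range (n + 1), c * ((m : ℝ) + 1) ^ D) * (D + 1) := by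
            rw [← Finset.mul_sum]; ring
        _ ≤ _ := by
            gcongr with m hm
            simpa using hlow m
    · cases m with
      | zero => exact key
      | succ m =>
        refine ⟨key, ?_⟩
        convert (hsym m).shift using 3 with _ n
        · push_cast; ring
        · beta_reduce
          rw [hrec (n + 1), hrec n, Finset.sum_range_succ _ (n + 1)]
          ring

/-- The quotient `Γ(n + 1 + D / 2) / Γ(n + 1)`; up to a constant it is the square of the
normalization constant of `Y_{(n, …, n)}` in dimension `d = D + 2`. -/
noncomputable def gammaRatio (D n : ℕ) : ℝ :=
  Real.Gamma ((n : ℝ) + 1 + (D : ℝ) / 2) / Real.Gamma ((n : ℝ) + 1)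

theorem gammaRatio_pos (D n : ℕ) : 0 < gammaRatio D n :=
  div_pos (Real.Gamma_pos_of_pos (by positivity)) (Real.Gamma_pos_of_pos (by positivity))

/-- Log-convexity of the Gamma function at midpoints. -/
theorem sq_Gamma_add_half_le {x : ℝ} (hx : 0 < x) :
    Real.Gamma (x + 1 / 2) ^ 2 ≤ Real.Gamma x * Real.Gamma (x + 1) := by
  have h := Real.Gamma_mul_add_mul_le_rpow_Gamma_mul_rpow_Gamma (s := x) (t := x + 1) (a := 1 / 2)
    (b := 1 / 2) hx (by linarith) (by norm_num) (by norm_num) (by norm_num)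
  have h1 := (Real.Gamma_pos_of_pos hx).le
  have h2 := (Real.Gamma_pos_of_pos (show 0 < x + 1 by linarith)).le
  rw [show 1 / 2 * x + 1 / 2 * (x + 1) = x + 1 / 2 by ring, ← Real.sqrt_eq_rpow,
    ← Real.sqrt_eq_rpow, ← Real.sqrt_mul h1] at h
  have h3 := Real.Gamma_pos_of_pos (show 0 < x + 1 / 2 by linarith)
  calc Real.Gamma (x + 1 / 2) ^ 2 ≤ √(Real.Gamma x * Real.Gamma (x + 1)) ^ 2 := by gcongr
    _ = _ := Real.sq_sqrt (by positivity)

theorem Gamma_half_step {x : ℝ} (hx : 1 / 2 ≤ x) :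
    √(x / 2) * Real.Gamma x ≤ Real.Gamma (x + 1 / 2) ∧
      Real.Gamma (x + 1 / 2) ≤ √x * Real.Gamma x := by
  have hx0 : 0 < x := by linarith
  have g0 := Real.Gamma_pos_of_pos hx0
  have g1 := Real.Gamma_pos_of_pos (show 0 < x + 1 / 2 by linarith)
  have h1 := sq_Gamma_add_half_le hx0
  have h2 := sq_Gamma_add_half_le (show 0 < x + 1 / 2 by linarith)
  rw [show x + 1 / 2 + 1 / 2 = x + 1 by ring, Real.Gamma_add_one hx0.ne',
    Real.Gamma_add_one (by linarith)] at h2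
  rw [Real.Gamma_add_one hx0.ne'] at h1
  constructor
  · refine abs_le_of_sq_le_sq' ?_ g1.le |>.2
    rw [mul_pow, Real.sq_sqrt (by positivity)]
    have h3 : (x * Real.Gamma x) ^ 2 ≤ (2 * x) * Real.Gamma (x + 1 / 2) ^ 2 := by
      refine h2.trans ?_
      nlinarith [sq_nonneg (Real.Gamma (x + 1 / 2))]
    have h4 : x * (x / 2 * Real.Gamma x ^ 2) ≤ x * Real.Gamma (x + 1 / 2) ^ 2 := by nlinarith
    exact le_of_mul_le_mul_left h4 hx0
  · refine abs_le_of_sq_le_sq' ?_ (by positivity) |>.2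
    rw [mul_pow, Real.sq_sqrt hx0.le]
    linarith

theorem gammaRatio_bounds (D : ℕ) : ∃ c C : ℝ, 0 < c ∧ 0 < C ∧ ∀ n : ℕ,
    c * ((n : ℝ) + 1) ^ ((D : ℝ) / 2) ≤ gammaRatio D n ∧
      gammaRatio D n ≤ C * ((n : ℝ) + 1) ^ ((D : ℝ) / 2) := by
  induction D with
  | zero =>
    refine ⟨1, 1, one_pos, one_pos, fun n => ?_⟩
    have h := (Real.Gamma_pos_of_pos (show (0 : ℝ) < n + 1 by positivity)).ne'
    simp [gammaRatio, h]
  | succ D ih =>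
    obtain ⟨c, C, hc, hC, h⟩ := ih
    refine ⟨√(1 / 2) * c, √(D + 1) * C, by positivity, by positivity, fun n => ?_⟩
    obtain ⟨h1, h2⟩ := h n
    set x : ℝ := (n : ℝ) + 1 + (D : ℝ) / 2 with hx
    have hn0 : (0 : ℝ) ≤ n := by positivity
    have hD0 : (0 : ℝ) ≤ D := by positivity
    obtain ⟨h3, h4⟩ := Gamma_half_step (x := x) (by rw [hx]; linarith)
    have hg := Real.Gamma_pos_of_pos (show (0 : ℝ) < n + 1 by positivity)
    have hpow : ((n : ℝ) + 1) ^ (((D + 1 : ℕ) : ℝ) / 2) =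
        √((n : ℝ) + 1) * ((n : ℝ) + 1) ^ ((D : ℝ) / 2) := by
      rw [Real.sqrt_eq_rpow, ← Real.rpow_add (by positivity)]
      congr 1
      push_cast
      ring
    have hrat : gammaRatio (D + 1) n = Real.Gamma (x + 1 / 2) / Real.Gamma ((n : ℝ) + 1) := by
      rw [gammaRatio, hx]
      congr 2
      push_cast
      ring
    have hrat' : gammaRatio D n = Real.Gamma x / Real.Gamma ((n : ℝ) + 1) := rfl
    rw [hpow, hrat]
    constructor
    · calc √(1 / 2) * c * (√((n : ℝ) + 1) * ((n : ℝ) + 1) ^ ((D : ℝ) / 2))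
          = √(((n : ℝ) + 1) / 2) * (c * ((n : ℝ) + 1) ^ ((D : ℝ) / 2)) := by
            rw [div_eq_mul_one_div ((n : ℝ) + 1), Real.sqrt_mul (by positivity)]; ring
        _ ≤ √(x / 2) * gammaRatio D n := by
            gcongr
            rw [hx]; linarith
        _ = √(x / 2) * Real.Gamma x / Real.Gamma ((n : ℝ) + 1) := by rw [hrat']; ring
        _ ≤ _ := by gcongr
    · calc Real.Gamma (x + 1 / 2) / Real.Gamma ((n : ℝ) + 1)
          ≤ √x * Real.Gamma x / Real.Gamma ((n : ℝ) + 1) := by gcongr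
        _ = √x * gammaRatio D n := by rw [hrat']; ring
        _ ≤ √((D + 1) * ((n : ℝ) + 1)) * (C * ((n : ℝ) + 1) ^ ((D : ℝ) / 2)) := by
            gcongr
            · exact (gammaRatio_pos D n).le
            · rw [hx]; nlinarith [mul_nonneg hD0 hn0]
        _ = _ := by rw [Real.sqrt_mul (by positivity)]; ring

/-- The recursion `w (n + 1) - w n = (D / 2) w n / (n + 1)` makes the Gamma quotient a symbol. -/
theorem gammaRatio_symbol (D m : ℕ) :
    IsSymbol m ((D : ℝ) / 2) (fun (_ : Unit) n => gammaRatio D n) := by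
  have key : ∃ C : ℝ, ∀ (_ : Unit) (n : ℕ),
      |gammaRatio D n| ≤ C * ((n : ℝ) + 1) ^ ((D : ℝ) / 2) := by
    obtain ⟨_, C, _, _, h⟩ := gammaRatio_bounds D
    exact ⟨C, fun _ n => by rw [abs_of_pos (gammaRatio_pos D n)]; exact (h n).2⟩
  induction m with
  | zero => exact key
  | succ m ih =>
    refine ⟨key, ?_⟩
    have h1 := (IsSymbol.affine (ι := Unit) (m := m) 1 1).inv (c := 1) one_pos
      (fun _ n => by rw [Real.rpow_one]; linarith)
    have h2 := (ih.mul h1).const_mul ((D : ℝ) / 2)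
    have e : ∀ n, gammaRatio D (n + 1) - gammaRatio D n =
        (D : ℝ) / 2 * (gammaRatio D n * (1 * (n : ℝ) + 1)⁻¹) := fun n => by
      have hn : (n : ℝ) + 1 ≠ 0 := by positivity
      have hx : (n : ℝ) + 1 + (D : ℝ) / 2 ≠ 0 := by positivity
      have hg := (Real.Gamma_pos_of_pos (show (0 : ℝ) < n + 1 by positivity)).ne'
      rw [gammaRatio, gammaRatio, show ((n + 1 : ℕ) : ℝ) + 1 = ((n : ℝ) + 1) + 1 by push_cast; ring,
        Real.Gamma_add_one hn,
        show (n : ℝ) + 1 + 1 + (D : ℝ) / 2 = ((n : ℝ) + 1 + (D : ℝ) / 2) + 1 by ring,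
        Real.Gamma_add_one hx, one_mul]
      field_simp
      ring
    simp only [e, sub_eq_add_neg] at h2 ⊢
    exact h2

theorem prod_div_telescope (g : ℕ → ℝ) (hg : ∀ j, g j ≠ 0) (M : ℕ) :
    ∏ j ∈ Finset.range M, g j / g (j + 1) = g 0 / g M := by
  induction M with
  | zero => simp [hg 0]
  | succ M ih => rw [Finset.prod_range_succ, ih, div_mul_div_cancel₀ (hg M)]

/-- A factor of the normalization constant, by the duplication formula. -/
theorem normConst_factor {s : ℝ} (hs : 0 < s) (x : ℝ) :
    2 ^ x * (2 * s) * Real.Gamma s ^ 2 / (√Real.pi * Real.Gamma (2 * s)) =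
      2 ^ (x + 2 - 2 * s) * (Real.Gamma (s + 1) / Real.Gamma (s + 1 / 2)) := by
  have h := Real.Gamma_mul_Gamma_add_half s
  have g0 := (Real.Gamma_pos_of_pos hs).ne'
  have g1 := (Real.Gamma_pos_of_pos (show 0 < s + 1 / 2 by linarith)).ne'
  have g2 := (Real.Gamma_pos_of_pos (show 0 < 2 * s by linarith)).ne'
  have hpi : √Real.pi ≠ 0 := by positivity
  have h2 : (2 : ℝ) ^ (x + 2 - 2 * s) = 2 ^ x * 2 * 2 ^ (1 - 2 * s) := by
    rw [show x + 2 - 2 * s = x + 1 + (1 - 2 * s) by ring, Real.rpow_add two_pos,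
      Real.rpow_add_one two_ne_zero]
  rw [Real.Gamma_add_one hs.ne', h2, mul_div_assoc', div_eq_div_iff (by positivity) g1]
  linear_combination 2 ^ x * 2 * s * Real.Gamma s * h

theorem exists_normConst_eq_sqrt (D : ℕ) (hD : 1 ≤ D) : ∃ C : ℝ, 0 < C ∧ ∀ n : ℕ,
    normConst (D + 2) n (extremeIndex (D + 2) n n) = √(C * gammaRatio D n) := by
  have hg := Real.Gamma_pos_of_pos (show 0 < ((D + 2 : ℕ) : ℝ) / 2 by positivity)
  refine ⟨(2 : ℝ) ^ ((((D + 2 : ℕ) : ℤ) - 4) * (((D + 2 : ℕ) : ℤ) - 2)) /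
    Real.Gamma (((D + 2 : ℕ) : ℝ) / 2) * ((2 : ℝ) ^ (2 - (D : ℝ))) ^ D, by positivity,
    fun n => ?_⟩
  rw [normConst, mul_assoc]
  congr 2
  rw [show D + 2 - 2 = D by omega]
  set g : ℕ → ℝ := fun j => Real.Gamma ((n : ℝ) + 1 + |(D : ℝ) - j| / 2) with hgdef
  have hg0 : ∀ j, g j ≠ 0 := fun j => (Real.Gamma_pos_of_pos (by positivity)).ne'
  have hratio : gammaRatio D n = ∏ j ∈ Finset.range D, g j / g (j + 1) := by
    rw [prod_div_telescope g hg0, gammaRatio, hgdef]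
    simp
  rw [hratio, ← Finset.card_range D, ← Finset.prod_const, Finset.card_range,
    ← Finset.prod_mul_distrib]
  refine Finset.prod_congr rfl fun j hj => ?_
  rw [Finset.mem_range] at hj
  have hp : (n : ℤ).natAbs = n := Int.natAbs_natCast n
  rw [absIdx_extremeIndex (by omega) hp (by omega), absIdx_extremeIndex (by omega) hp (by omega),
    Nat.sub_self, Nat.factorial_zero, Nat.cast_one, mul_one]
  have hjD : (j : ℝ) + 1 ≤ D := by exact_mod_cast hj
  have hs : 0 < (n : ℝ) + ((D : ℝ) - j) / 2 := by
    have : (0 : ℝ) ≤ n := by positivity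
    linarith
  have h := normConst_factor hs (2 * n - j)
  have e1 : g j = Real.Gamma ((n : ℝ) + ((D : ℝ) - j) / 2 + 1) := by
    rw [hgdef]; simp only; rw [abs_of_nonneg (by linarith)]; congr 1; ring
  have e2 : g (j + 1) = Real.Gamma ((n : ℝ) + ((D : ℝ) - j) / 2 + 1 / 2) := by
    rw [hgdef]; simp only; rw [abs_of_nonneg (by push_cast; linarith)]; congr 1; push_cast; ring
  rw [e1, e2]
  convert h using 2
  · rw [← Real.rpow_intCast]
    push_cast
    congr 2
    · ring
    · congr 1; ring
  · congr 2; push_cast; ring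
  · congr 1; ring

/-- The amplitudes are an elliptic symbol of order `3 (d - 2) / 4`: the dimension contributes
`(d - 2) / 2` and the normalization constant contributes `(d - 2) / 4`. -/
theorem amplitude_symbol (D : ℕ) (hD : 1 ≤ D) :
    (∃ c : ℝ, 0 < c ∧ ∀ n : ℕ, c * ((n : ℝ) + 1) ^ (3 * (D : ℝ) / 4) ≤ amplitude (D + 2) n) ∧
      ∀ m, IsSymbol m (3 * (D : ℝ) / 4) (fun (_ : Unit) => amplitude (D + 2)) := by
  obtain ⟨⟨c₁, hc₁, h₁⟩, hs₁⟩ := card_indexSet_symbol D hD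
  obtain ⟨c₂, _, hc₂, _, h₂⟩ := gammaRatio_bounds D
  obtain ⟨C, hC, hN⟩ := exists_normConst_eq_sqrt D hD
  have hamp : ∀ n, amplitude (D + 2) n =
      √(2 * C * (((indexSet (D + 2) n).card : ℝ) * gammaRatio D n)) := fun n => by
    rw [amplitude, hN, finrank_harmonicSpace hD, ← Real.sqrt_mul (by positivity),
      ← Real.sqrt_mul (by norm_num)]
    congr 1
    ring
  have hlow : ∀ n : ℕ, 2 * C * (c₁ * c₂) * ((n : ℝ) + 1) ^ (2 * (3 * (D : ℝ) / 4)) ≤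
      2 * C * (((indexSet (D + 2) n).card : ℝ) * gammaRatio D n) := fun n => by
    rw [show 2 * (3 * (D : ℝ) / 4) = D + D / 2 by ring, Real.rpow_add (by positivity)]
    calc 2 * C * (c₁ * c₂) * (((n : ℝ) + 1) ^ (D : ℝ) * ((n : ℝ) + 1) ^ ((D : ℝ) / 2))
        = 2 * C * ((c₁ * ((n : ℝ) + 1) ^ (D : ℝ)) * (c₂ * ((n : ℝ) + 1) ^ ((D : ℝ) / 2))) := by ring
      _ ≤ _ := mul_le_mul_of_nonneg_left
        (mul_le_mul (h₁ n) (h₂ n).1 (by positivity) (by positivity)) (by positivity)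
  constructor
  · refine ⟨√(2 * C * (c₁ * c₂)), by positivity, fun n => ?_⟩
    rw [hamp]
    refine le_trans (le_of_eq ?_) (Real.sqrt_le_sqrt (hlow n))
    rw [Real.sqrt_mul (show 0 ≤ 2 * C * (c₁ * c₂) by positivity), mul_comm (2 : ℝ) (3 * (D : ℝ) / 4),
      Real.rpow_mul (by positivity), Real.rpow_two, Real.sqrt_sq (by positivity)]
  · intro m
    have h3 := ((hs₁ m).mul (gammaRatio_symbol D m)).const_mul (2 * C)
    rw [show (D : ℝ) + D / 2 = 2 * (3 * (D : ℝ) / 4) by ring] at h3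
    have h4 := h3.sqrt (c := 2 * C * (c₁ * c₂)) (by positivity) (fun _ n => hlow n)
    convert h4 using 2
    funext n
    exact hamp n

/-! ### The window -/

section Window

variable {φ : ℝ → ℝ}

theorem window_eq_zero_of_le_half (h1 : ∀ t ∈ Set.Icc (0 : ℝ) (1 / 2), φ t = 1) {t : ℝ}
    (h0 : 0 ≤ t) (ht : t ≤ 1 / 2) : window φ t = 0 := by
  rw [window, h1 t ⟨h0, ht⟩, h1 (t / 2) ⟨by linarith, by linarith⟩]
  simp

theorem window_eq_zero_of_two_le (h2 : ∀ t ∈ Set.Ici (1 : ℝ), φ t = 0) {t : ℝ}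
    (ht : 2 ≤ t) : window φ t = 0 := by
  rw [window, h2 t (by rw [Set.mem_Ici]; linarith), h2 (t / 2) (by rw [Set.mem_Ici]; linarith)]
  simp

theorem window_one (h1 : ∀ t ∈ Set.Icc (0 : ℝ) (1 / 2), φ t = 1)
    (h2 : ∀ t ∈ Set.Ici (1 : ℝ), φ t = 0) : window φ 1 = 1 := by
  rw [window, h1 (1 / 2) ⟨by norm_num, le_rfl⟩, h2 1 Set.self_mem_Ici]
  simp

/-- The window on `[0, ∞)`, extended by zero to the real line. -/
noncomputable def windowExt (φ : ℝ → ℝ) (t : ℝ) : ℝ := if t ≤ 0 then 0 else window φ t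

theorem windowExt_of_nonneg (h1 : ∀ t ∈ Set.Icc (0 : ℝ) (1 / 2), φ t = 1) {t : ℝ} (ht : 0 ≤ t) :
    windowExt φ t = window φ t := by
  rw [windowExt]
  split_ifs with h
  · rw [le_antisymm h ht, window_eq_zero_of_le_half h1 le_rfl (by norm_num)]
  · rfl

theorem windowExt_eq_zero_of_le_half (h1 : ∀ t ∈ Set.Icc (0 : ℝ) (1 / 2), φ t = 1) {t : ℝ}
    (ht : t ≤ 1 / 2) : windowExt φ t = 0 := by
  rw [windowExt]
  split_ifs with h
  · rfl
  · exact window_eq_zero_of_le_half h1 (not_le.1 h).le ht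

theorem windowExt_eq_zero_of_two_le (h2 : ∀ t ∈ Set.Ici (1 : ℝ), φ t = 0) {t : ℝ}
    (ht : 2 ≤ t) : windowExt φ t = 0 := by
  rw [windowExt, if_neg (by linarith), window_eq_zero_of_two_le h2 ht]

theorem windowExt_nonneg (t : ℝ) : 0 ≤ windowExt φ t := by
  rw [windowExt]
  split_ifs
  · exact le_rfl
  · exact Real.sqrt_nonneg _

theorem contDiff_windowExt {q : ℕ} (h1 : ∀ t ∈ Set.Icc (0 : ℝ) (1 / 2), φ t = 1)
    (hκ : ContDiffOn ℝ q (window φ) (Set.Ici 0)) : ContDiff ℝ q (windowExt φ) := by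
  rw [contDiff_iff_contDiffAt]
  intro t
  rcases lt_or_ge t (1 / 2) with ht | ht
  · refine (contDiffAt_const (c := (0 : ℝ))).congr_of_eventuallyEq ?_
    filter_upwards [Iio_mem_nhds ht] with s hs
    exact windowExt_eq_zero_of_le_half h1 (le_of_lt hs)
  · have ht0 : 0 < t := by linarith
    refine (hκ.contDiffAt (Ici_mem_nhds ht0)).congr_of_eventuallyEq ?_
    filter_upwards [Ici_mem_nhds ht0] with s hs
    exact windowExt_of_nonneg h1 hs

theorem hasCompactSupport_windowExt (h2 : ∀ t ∈ Set.Ici (1 : ℝ), φ t = 0) :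
    HasCompactSupport (windowExt φ) := by
  refine HasCompactSupport.intro (isCompact_Icc (a := (0 : ℝ)) (b := 2)) fun t ht => ?_
  rcases le_or_gt t 0 with h | h
  · rw [windowExt, if_pos h]
  · exact windowExt_eq_zero_of_two_le h2 (by
      by_contra h'
      exact ht ⟨h.le, (not_le.1 h').le⟩)

end Window

/-! ### Norms of the curvelets -/

theorem re_kernel (b : ℕ → ℝ) (K : ℝ → ℝ) (N : ℕ) (z : ℂ) :
    (kernel b K N z).re = ∑ n ∈ Finset.range (2 * N), b n * K (n / N) * (z ^ n).re := by
  rw [kernel, Complex.re_sum]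
  exact Finset.sum_congr rfl fun n _ => Complex.re_ofReal_mul _ _

theorem re_kernel_one (b : ℕ → ℝ) (K : ℝ → ℝ) (N : ℕ) :
    (kernel b K N 1).re = ∑ n ∈ Finset.range (2 * N), b n * K (n / N) := by
  rw [re_kernel]
  simp

theorem abs_re_kernel_le {b : ℕ → ℝ} {K : ℝ → ℝ} (hb : ∀ n, 0 ≤ b n) (hK : ∀ t, 0 ≤ K t) (N : ℕ)
    {z : ℂ} (hz : ‖z‖ ≤ 1) : |(kernel b K N z).re| ≤ (kernel b K N 1).re := by
  rw [re_kernel, re_kernel_one]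
  refine (Finset.abs_sum_le_sum_abs _ _).trans (Finset.sum_le_sum fun n _ => ?_)
  rw [abs_mul, abs_of_nonneg (mul_nonneg (hb n) (hK _))]
  refine mul_le_of_le_one_right (mul_nonneg (hb n) (hK _)) ((Complex.abs_re_le_norm _).trans ?_)
  rw [norm_pow]
  exact pow_le_one₀ (norm_nonneg _) hz

theorem half_le_re_kernel {b : ℕ → ℝ} {K : ℝ → ℝ} (hb : ∀ n, 0 ≤ b n) (hK : ∀ t, 0 ≤ K t) (N : ℕ)
    {z : ℂ} (hz : ‖z‖ ≤ 1) (h : 4 * N * ‖z - 1‖ ≤ 1) :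
    (kernel b K N 1).re / 2 ≤ (kernel b K N z).re := by
  rw [re_kernel_one, re_kernel, Finset.sum_div]
  refine Finset.sum_le_sum fun n hn => ?_
  have := half_le_re_pow hz (Finset.mem_range.1 hn).le h
  have h0 := mul_nonneg (hb n) (hK (n / N))
  nlinarith

theorem lpNorm_eq {d : ℕ} {p : ℝ} (hp : 0 < p) (f : Sph d → ℂ) :
    lpNorm d p f = (∫⁻ η, ENNReal.ofReal (‖f η‖ ^ p) ∂(sphMeasure d)) ^ (1 / p) := by
  rw [lpNorm, eLpNorm_eq_lintegral_rpow_enorm_toReal (by simpa using hp) ENNReal.ofReal_ne_top,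
    ENNReal.toReal_ofReal hp.le]
  congr 1
  refine lintegral_congr fun η => ?_
  rw [← ofReal_norm, ENNReal.ofReal_rpow_of_nonneg (norm_nonneg _) hp.le]

theorem rpow_root_eq {B C N α e p : ℝ} (hB : 0 < B) (hC : 0 < C) (hN : 0 < N) (hp : 0 < p) :
    ((B * N ^ α) ^ p * (C * N ^ (-(e / 2)))) ^ (1 / p) =
      (B * C ^ (1 / p)) * N ^ (α - e / (2 * p)) := by
  have hNα : 0 < N ^ α := Real.rpow_pos_of_pos hN α
  rw [Real.mul_rpow (by positivity) (by positivity), ← Real.rpow_mul (by positivity),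
    mul_one_div_cancel hp.ne', Real.rpow_one, Real.mul_rpow hC.le (by positivity),
    ← Real.rpow_mul hN.le, Real.rpow_sub hN, show -(e / 2) * (1 / p) = -(e / (2 * p)) by
      field_simp, Real.rpow_neg hN.le]
  ring

theorem lpNorm_re_kernel_le {D q : ℕ} {p : ℝ} (hp : 0 < p) (hpq : 1 / p < q) {K : ℝ → ℝ}
    (hK : ContDiff ℝ q K) (hc : HasCompactSupport K) (hK1 : ∀ t, t ≤ 1 / 2 → K t = 0)
    (hK2 : ∀ t, 2 ≤ t → K t = 0) {b : ℕ → ℝ} {α : ℝ} (hb : IsSymbol q α (fun _ : Unit => b)) :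
    ∃ C : ℝ, 0 < C ∧ ∀ N : ℕ, 1 ≤ N →
      lpNorm (D + 2) p (fun η => ((kernel b K N (planePart η)).re : ℂ)) ≤
        ENNReal.ofReal (C * (N : ℝ) ^ (α + 1 - ((D + 2 : ℕ) : ℝ) / (2 * p))) := by
  obtain ⟨B, hB, hker⟩ := kernel_bound hK hc hK1 hK2 hb
  obtain ⟨C, hC, hint⟩ := lintegral_majorant_le D (s := q * p) (lam := p / 4)
    (by rwa [div_lt_iff₀ hp] at hpq) (by positivity)
  refine ⟨B * C ^ (1 / p), by positivity, fun N hN => ?_⟩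
  have hN0 : (0 : ℝ) < N := by exact_mod_cast hN
  rw [lpNorm_eq hp, ← rpow_root_eq hB hC hN0 hp,
    ← ENNReal.ofReal_rpow_of_nonneg (by positivity) (by positivity)]
  refine ENNReal.rpow_le_rpow ?_ (by positivity)
  have hpt : ∀ η : Sph (D + 2),
      ENNReal.ofReal (‖((kernel b K N (planePart η)).re : ℂ)‖ ^ p) ≤
        ENNReal.ofReal ((B * (N : ℝ) ^ (α + 1)) ^ p) *
          ENNReal.ofReal ((1 + N * |(planePart η).im|) ^ (-(q * p)) *
            Real.exp (-(p / 4 * N * (1 - ‖planePart η‖ ^ 2)))) := by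
    intro η
    rw [← ENNReal.ofReal_mul (by positivity)]
    apply ENNReal.ofReal_le_ofReal
    set z := planePart η
    have hw : 0 < 1 + N * |z.im| := by positivity
    have h1 : ‖((kernel b K N z).re : ℂ)‖ ≤ (B * (N : ℝ) ^ (α + 1)) *
        ((1 + N * |z.im|) ^ (-(q : ℝ)) * Real.exp (-(N * (1 - ‖z‖ ^ 2)) / 4)) := by
      rw [Complex.norm_real, Real.norm_eq_abs, Real.rpow_neg hw.le, Real.rpow_natCast,
        mul_left_comm, ← div_eq_inv_mul, le_div_iff₀ (by positivity)]
      refine le_trans ?_ (hker N hN z (norm_planePart_le η))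
      gcongr
      exact Complex.abs_re_le_norm _
    calc ‖((kernel b K N z).re : ℂ)‖ ^ p ≤ ((B * (N : ℝ) ^ (α + 1)) *
          ((1 + N * |z.im|) ^ (-(q : ℝ)) * Real.exp (-(N * (1 - ‖z‖ ^ 2)) / 4))) ^ p :=
          Real.rpow_le_rpow (norm_nonneg _) h1 hp.le
      _ = _ := by
        have h2 : ((1 + N * |z.im|) ^ (-(q : ℝ)) * Real.exp (-(N * (1 - ‖z‖ ^ 2)) / 4)) ^ p =
            (1 + N * |z.im|) ^ (-(q * p)) * Real.exp (-(p / 4 * N * (1 - ‖z‖ ^ 2))) := by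
          rw [Real.mul_rpow (by positivity) (by positivity), ← Real.rpow_mul hw.le, ← Real.exp_mul]
          congr 2
          · ring
          · ring
        rw [Real.mul_rpow (by positivity) (by positivity), h2]
  refine (lintegral_mono hpt).trans ?_
  rw [lintegral_const_mul' _ _ ENNReal.ofReal_ne_top, ENNReal.ofReal_mul (by positivity)]
  gcongr
  exact hint N hN0

theorem lpNorm_re_kernel_ge {D : ℕ} {p : ℝ} (hp : 0 < p) {K : ℝ → ℝ}
    (hK0 : ∀ t, 0 ≤ K t) {b : ℕ → ℝ} (hb : ∀ n, 0 ≤ b n) {α A : ℝ} (hA : 0 < A)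
    (hsum : ∀ N : ℕ, 1 ≤ N → A * (N : ℝ) ^ α ≤ (kernel b K N 1).re) :
    ∃ C : ℝ, 0 < C ∧ ∀ N : ℕ, 1 ≤ N →
      ENNReal.ofReal (C * (N : ℝ) ^ (α - ((D + 2 : ℕ) : ℝ) / (2 * p))) ≤
        lpNorm (D + 2) p (fun η => ((kernel b K N (planePart η)).re : ℂ)) := by
  obtain ⟨C, hC, hmeas⟩ := sphMeasure_near_one_ge D
  refine ⟨(A / 2) * C ^ (1 / p), by positivity, fun N hN => ?_⟩
  have hN1 : (1 : ℝ) ≤ N := by exact_mod_cast hN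
  have hN0 : (0 : ℝ) < N := by linarith
  rw [lpNorm_eq hp, ← rpow_root_eq (by positivity) hC hN0 hp,
    ← ENNReal.ofReal_rpow_of_nonneg (by positivity) (by positivity)]
  refine ENNReal.rpow_le_rpow ?_ (by positivity)
  set R : Set (Sph (D + 2)) := {η | 4 * (N : ℝ) * ‖planePart η - 1‖ ≤ 1} with hR
  have hRm : MeasurableSet R := by
    apply IsClosed.measurableSet
    have := continuous_planePart (D := D)
    exact isClosed_le (by fun_prop) continuous_const
  rw [ENNReal.ofReal_mul (by positivity)]
  calc _ ≤ ENNReal.ofReal ((A / 2 * (N : ℝ) ^ α) ^ p) * sphMeasure (D + 2) R := by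
        gcongr; exact hmeas N hN1
    _ = ∫⁻ _ in R, ENNReal.ofReal ((A / 2 * (N : ℝ) ^ α) ^ p) ∂(sphMeasure (D + 2)) :=
        (setLIntegral_const _ _).symm
    _ ≤ ∫⁻ η in R, ENNReal.ofReal (‖((kernel b K N (planePart η)).re : ℂ)‖ ^ p)
          ∂(sphMeasure (D + 2)) := by
        refine setLIntegral_mono' hRm fun η hη => ?_
        apply ENNReal.ofReal_le_ofReal
        refine Real.rpow_le_rpow (by positivity) ?_ hp.le
        rw [Complex.norm_real, Real.norm_eq_abs]
        have h1 := half_le_re_kernel hb hK0 N (norm_planePart_le η) hη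
        have h2 := hsum N hN
        have h3 := le_abs_self (kernel b K N (planePart η)).re
        linarith
    _ ≤ _ := setLIntegral_le_lintegral _ _

/-- After the rotation, the curvelet is the real part of the kernel in the last two coordinates. -/
theorem curvelet_succ_eq {D : ℕ} (hD : 1 ≤ D) {φ : ℝ → ℝ}
    (h1 : ∀ t ∈ Set.Icc (0 : ℝ) (1 / 2), φ t = 1) (h2 : ∀ t ∈ Set.Ici (1 : ℝ), φ t = 0)
    (g : Matrix.specialOrthogonalGroup (Fin (D + 2)) ℝ)
    (hg1 : rotate g (basisPoint ⟨0, by omega⟩) = basisPoint ⟨D, by omega⟩)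
    (hg2 : rotate g (basisPoint ⟨1, by omega⟩) = basisPoint ⟨D + 1, by omega⟩) (j : ℕ) :
    curvelet (D + 2) φ g (j + 1) = fun η =>
      ((kernel (amplitude (D + 2)) (windowExt φ) (2 ^ j) (planePart η)).re : ℂ) := by
  funext η
  rw [curvelet, rotationOp, curvelet₀_succ (by omega)
    (window_eq_zero_of_le_half h1 le_rfl (by norm_num)) (fun t ht => window_eq_zero_of_two_le h2 ht),
    firstPlanePart_rotate_inv (by omega) g hg1 hg2, kernel]
  congr 2
  refine Finset.sum_congr rfl fun n _ => ?_
  rw [windowExt_of_nonneg h1 (by positivity)]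
  rfl

theorem lpNorm_curvelet_zero {D : ℕ} {p : ℝ} (hp : 0 < p) (φ : ℝ → ℝ)
    (g : Matrix.specialOrthogonalGroup (Fin (D + 2)) ℝ) :
    lpNorm (D + 2) p (curvelet (D + 2) φ g 0) = 1 := by
  have h : curvelet (D + 2) φ g 0 = fun _ => 1 := rfl
  rw [h, lpNorm_eq hp]
  simp

theorem natCast_two_pow_rpow (j : ℕ) (x : ℝ) :
    ((2 ^ j : ℕ) : ℝ) ^ x = 2 ^ (-x) * 2 ^ (((j + 1 : ℕ) : ℝ) * x) := by
  rw [← Real.rpow_add two_pos, Nat.cast_pow, Nat.cast_ofNat, ← Real.rpow_natCast,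
    ← Real.rpow_mul two_pos.le]
  congr 1
  push_cast
  ring

theorem planePart_basisPoint_last {D : ℕ} :
    planePart (basisPoint (Fin.last (D + 1)) : Sph (D + 2)) = 1 := by
  apply Complex.ext
  · simp [planePart, basisPoint]
  · simp [planePart, basisPoint, Fin.ext_iff]

end Curvelet

open Curvelet in
theorem corollary4p2 (d : ℕ) (hd : 3 ≤ d) (q : ℕ) (hq : 1 ≤ q) (φ : ℝ → ℝ)
    (hφ : ContDiffOn ℝ q φ (Set.Ici 0)) (hφ_anti : AntitoneOn φ (Set.Ici 0))
    (hφ_one : ∀ t ∈ Set.Icc (0 : ℝ) (1 / 2), φ t = 1) (hφ_zero : ∀ t ∈ Set.Ici (1 : ℝ), φ t = 0)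
    (hκ : ContDiffOn ℝ q (Curvelet.window φ) (Set.Ici 0))
    (hκ_ne : ∃ t₀ ∈ Set.Ioo (1 / 2 : ℝ) 2, ∀ t ∈ Set.Ioo (1 / 2 : ℝ) t₀,
      iteratedDerivWithin q (Curvelet.window φ) (Set.Ici 0) t ≠ 0) :
    (∀ p : ℝ, 0 < p → 1 / p < (q : ℝ) →
      ∃ c₁ c₂ : ℝ, 0 < c₁ ∧ c₁ ≤ c₂ ∧
        ∀ g₀ : Matrix.specialOrthogonalGroup (Fin d) ℝ,
          Curvelet.rotate g₀ (Curvelet.basisPoint ⟨0, by omega⟩) =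
            Curvelet.basisPoint ⟨d - 2, by omega⟩ →
          Curvelet.rotate g₀ (Curvelet.basisPoint ⟨1, by omega⟩) =
            Curvelet.basisPoint ⟨d - 1, by omega⟩ →
          ∀ j : ℕ,
            ENNReal.ofReal
                (c₁ * (2 : ℝ) ^ ((j : ℝ) * ((3 * (d : ℝ) - 2) / 4 - (d : ℝ) / (2 * p)))) ≤
              Curvelet.lpNorm d p (Curvelet.curvelet d φ g₀ j) ∧
            Curvelet.lpNorm d p (Curvelet.curvelet d φ g₀ j) ≤
              ENNReal.ofReal
                (c₂ * (2 : ℝ) ^ ((j : ℝ) * ((3 * (d : ℝ) - 2) / 4 - (d : ℝ) / (2 * p))))) ∧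
    (∃ c₁ c₂ : ℝ, 0 < c₁ ∧ c₁ ≤ c₂ ∧
      ∀ g₀ : Matrix.specialOrthogonalGroup (Fin d) ℝ,
        Curvelet.rotate g₀ (Curvelet.basisPoint ⟨0, by omega⟩) =
          Curvelet.basisPoint ⟨d - 2, by omega⟩ →
        Curvelet.rotate g₀ (Curvelet.basisPoint ⟨1, by omega⟩) =
          Curvelet.basisPoint ⟨d - 1, by omega⟩ →
        ∀ j : ℕ,
          Curvelet.supNorm d (Curvelet.curvelet d φ g₀ j) =
            ‖Curvelet.curvelet d φ g₀ j (Curvelet.basisPoint ⟨d - 1, by omega⟩)‖ₑ ∧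
          c₁ * (2 : ℝ) ^ ((j : ℝ) * (3 * (d : ℝ) - 2) / 4) ≤
            ‖Curvelet.curvelet d φ g₀ j (Curvelet.basisPoint ⟨d - 1, by omega⟩)‖ ∧
          ‖Curvelet.curvelet d φ g₀ j (Curvelet.basisPoint ⟨d - 1, by omega⟩)‖ ≤
            c₂ * (2 : ℝ) ^ ((j : ℝ) * (3 * (d : ℝ) - 2) / 4)) := by
  obtain ⟨D, rfl⟩ : ∃ D, d = D + 2 := ⟨d - 2, by omega⟩
  have hD : 1 ≤ D := by omega
  set b := amplitude (D + 2) with hb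
  set K := windowExt φ with hKdef
  set α : ℝ := 3 * (D : ℝ) / 4 with hα
  have hα1 : (3 * ((D + 2 : ℕ) : ℝ) - 2) / 4 = α + 1 := by rw [hα]; push_cast; ring
  obtain ⟨⟨c, hc, hlow⟩, hsym⟩ := amplitude_symbol D hD
  have hK : ContDiff ℝ q K := contDiff_windowExt hφ_one hκ
  have hKc : HasCompactSupport K := hasCompactSupport_windowExt hφ_zero
  have hK0 : ∀ t, 0 ≤ K t := windowExt_nonneg
  have hK1 : ∀ t, t ≤ 1 / 2 → K t = 0 := fun t ht => windowExt_eq_zero_of_le_half hφ_one ht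
  have hK2 : ∀ t, 2 ≤ t → K t = 0 := fun t ht => windowExt_eq_zero_of_two_le hφ_zero ht
  have hKone : K 1 = 1 := by
    rw [hKdef, windowExt_of_nonneg hφ_one zero_le_one, window_one hφ_one hφ_zero]
  have hb0 : ∀ n, 0 ≤ b n := fun n => le_trans (by positivity) (hlow n)
  obtain ⟨A, hA, hsum⟩ := sum_lower_bound hK.continuous hK0 (by rw [hKone]; exact one_pos)
    (show 0 ≤ α by positivity) hc hlow
  have hsum' : ∀ N : ℕ, 1 ≤ N → A * (N : ℝ) ^ (α + 1) ≤ (kernel b K N 1).re := fun N hN => by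
    rw [re_kernel_one]; exact hsum N hN
  have hpow : ∀ j : ℕ, 1 ≤ 2 ^ j := fun j => Nat.one_le_two_pow
  constructor
  · intro p hp hpq
    obtain ⟨C₁, hC₁, hge⟩ := lpNorm_re_kernel_ge (D := D) hp hK0 hb0 hA hsum'
    obtain ⟨C₂, hC₂, hle⟩ := lpNorm_re_kernel_le (D := D) hp hpq hK hKc hK1 hK2 (hsym q)
    set γ : ℝ := α + 1 - ((D + 2 : ℕ) : ℝ) / (2 * p) with hγ
    -- `1` takes care of `j = 0`, and the power of `2` of the scale `2 ^ (j - 1)` instead of `2 ^ j`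
    refine ⟨min 1 (C₁ * 2 ^ (-γ)), max 1 (C₂ * 2 ^ (-γ)), by positivity,
      (min_le_left _ _).trans (le_max_left _ _), fun g₀ hg1 hg2 j => ?_⟩
    rw [hα1, ← hγ]
    cases j with
    | zero =>
      rw [lpNorm_curvelet_zero hp, Nat.cast_zero, zero_mul, Real.rpow_zero, mul_one, mul_one]
      exact ⟨ENNReal.ofReal_le_one.2 (min_le_left _ _), ENNReal.one_le_ofReal.2 (le_max_left _ _)⟩
    | succ j =>
      rw [curvelet_succ_eq hD hφ_one hφ_zero g₀ hg1 hg2]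
      have h1 := hge (2 ^ j) (hpow j)
      have h2 := hle (2 ^ j) (hpow j)
      rw [natCast_two_pow_rpow, ← mul_assoc] at h1 h2
      refine ⟨le_trans (ENNReal.ofReal_le_ofReal ?_) h1,
        h2.trans (ENNReal.ofReal_le_ofReal ?_)⟩
      · gcongr; exact min_le_right _ _
      · gcongr; exact le_max_right _ _
  · -- the upper bound at the pole comes from the localization estimate at `z = 1`
    obtain ⟨B, hB, hker⟩ := kernel_bound hK hKc hK1 hK2 (hsym q)
    set β : ℝ := α + 1 with hβ
    refine ⟨min 1 (A * 2 ^ (-β)), max 1 (B * 2 ^ (-β)), by positivity,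
      (min_le_left _ _).trans (le_max_left _ _), fun g₀ hg1 hg2 j => ?_⟩
    rw [mul_div_assoc, hα1]
    cases j with
    | zero =>
      have h : curvelet (D + 2) φ g₀ 0 = fun _ => 1 := rfl
      have : Nonempty (Sph (D + 2)) := ⟨basisPoint 0⟩
      rw [h, supNorm, Nat.cast_zero, zero_mul, Real.rpow_zero, mul_one, mul_one, norm_one]
      exact ⟨ciSup_const, min_le_left _ _, le_max_left _ _⟩
    | succ j =>
      rw [curvelet_succ_eq hD hφ_one hφ_zero g₀ hg1 hg2]
      have hlast : planePart (basisPoint ⟨D + 2 - 1, by omega⟩ : Sph (D + 2)) = 1 :=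
        planePart_basisPoint_last
      simp only [hlast]
      have h1 := hsum' (2 ^ j) (hpow j)
      have h2 := hker (2 ^ j) (hpow j) 1 (by simp)
      rw [natCast_two_pow_rpow, ← mul_assoc] at h1 h2
      have h0 : 0 ≤ (kernel b K (2 ^ j) 1).re := le_trans (by positivity) h1
      refine ⟨le_antisymm (iSup_le fun η => ?_) ?_, ?_, ?_⟩
      · rw [← ofReal_norm, ← ofReal_norm]
        apply ENNReal.ofReal_le_ofReal
        rw [Complex.norm_real, Complex.norm_real, Real.norm_eq_abs, Real.norm_eq_abs,
          abs_of_nonneg h0]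
        exact abs_re_kernel_le hb0 hK0 _ (norm_planePart_le η)
      · refine le_iSup_of_le (basisPoint ⟨D + 2 - 1, by omega⟩) ?_
        simp only [hlast, le_refl]
      · rw [Complex.norm_real, Real.norm_eq_abs, abs_of_nonneg h0]
        refine le_trans ?_ h1
        gcongr
        exact min_le_right _ _
      · rw [Complex.norm_real, Real.norm_eq_abs]
        simp only [Complex.one_im, abs_zero, mul_zero, add_zero, one_pow, mul_one, norm_one,
          sub_self, neg_zero, zero_div, Real.exp_zero] at h2
        refine ((Complex.abs_re_le_norm _).trans h2).trans ?_
        gcongr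
        exact le_max_right _ _
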